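/- Let $G=(N,A)$ be a directed road network with finitely many arcs; arc $k\ell\in A$ has length $d_{k\ell}\ge 0$. For each arc $a\in A$ let $X_a(t)$, $t\ge 0$, be a right-continuous continuous-time Markov process on a finite set $\mathcal S_a=\{1,\dots,n_a\}$ with transition rate matrix $Q_a$, the processes $(X_a)_{a\in A}$ being independent. Let $B(t)=(X_a(t))_{a\in A}$ be the background process on $\mathcal I=\prod_{a\in A}\mathcal S_a$, and let $Q=\bigoplus_{a\in A}Q_a$ be the Kronecker sum of the $Q_a$. When $B(t)=s$, vehicles on arc $k\ell$ move at speed $v_{k\ell}(s)>0$; put $V_{k\ell}=\mathrm{diag}\{(v_{k\ell}(s))_{s\in\mathcal I}\}$. For a vehicle that enters arc $k\ell$ at time $0$, let $$\tau_{k\ell}=\min\Big\{t\ge 0:\int_0^t v_{k\ell}(B(u))\,\mathrm du\ge d_{k\ell}\Big\}$$ be the travel time of the arc. Then this minimum is attained and, for every arc $k\ell\in A$ and all $s,s'\in\mathcal I$ with $\mathbb P(B(0)=s)>0$, $$\mathbb P\big(B(\tau_{k\ell})=s'\,\big|\,B(0)=s\big)=\big[\exp\big(d_{k\ell}V_{k\ell}^{-1}Q\big)\big]_{s,s'}.$$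 -/

import Mathlib

open MeasureTheory ProbabilityTheory
open scoped NNReal

/-- `Q` is a transition rate matrix: nonnegative off-diagonal entries and zero row sums. -/
structure IsRateMatrix {S : Type*} [Fintype S] (Q : Matrix S S ℝ) : Prop where
  offDiag_nonneg : ∀ i j, i ≠ j → 0 ≤ Q i j
  row_sum : ∀ i, ∑ j, Q i j = 0

/-- The sigma-algebra of the history of the process `X` up to and including time `t`. -/
abbrev history {Ω S : Type*} [MeasurableSpace S] (X : ℝ≥0 → Ω → S) (t : ℝ≥0) :
    MeasurableSpace Ω :=
  ⨆ u ∈ Set.Iic t, MeasurableSpace.comap (X u) inferInstance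

/-- `X` is, under `P`, a (time-homogeneous) continuous-time Markov process on the finite set
`S = {1, …, n}` with transition rate matrix `Q` and right-continuous paths (infinitesimal
definition). The initial distribution is arbitrary. -/
structure IsMarkovProcess {Ω : Type*} [MeasurableSpace Ω] (P : Measure Ω) {n : ℕ}
    (Q : Matrix (Fin n) (Fin n) ℝ) (X : ℝ≥0 → Ω → Fin n) : Prop where
  measurable : ∀ t, Measurable (X t)
  right_continuous : ∀ ω t, ContinuousWithinAt (fun u => X u ω) (Set.Ici t) t
  /-- The Markov property: given the present state, the future state does not depend on any
  event `H` of the history. -/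
  markov : ∀ (t h : ℝ≥0) (H : Set Ω), MeasurableSet[history X t] H → ∀ i j : Fin n,
    P (H ∩ {ω | X t ω = i}) ≠ 0 →
      P[{ω | X (t + h) ω = j} | H ∩ {ω | X t ω = i}] =
        P[{ω | X (t + h) ω = j} | {ω | X t ω = i}]
  /-- The transition rates: `P(X(t+h) = j | X(t) = i) = 1{i = j} + h * Q i j + o(h)` as `h ↓ 0`,
  uniformly in `t`. -/
  rates : ∀ ε : ℝ, 0 < ε → ∃ δ : ℝ≥0, 0 < δ ∧ ∀ t h : ℝ≥0, 0 < h → h < δ → ∀ i j : Fin n,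
    P {ω | X t ω = i} ≠ 0 →
      |(P[{ω | X (t + h) ω = j} | {ω | X t ω = i}]).toReal
        - ((1 : Matrix (Fin n) (Fin n) ℝ) i j + (h : ℝ) * Q i j)| ≤ ε * (h : ℝ)

/-- The Kronecker sum of finitely many square matrices, with rows and columns indexed by the
product of the index sets: the sum over `i` of the tensor products whose `i`-th factor is `Q i`
and whose other factors are identity matrices. -/
def kroneckerSum {ι : Type*} [Fintype ι] [DecidableEq ι] {S : ι → Type*}
    [∀ i, DecidableEq (S i)] (Q : ∀ i, Matrix (S i) (S i) ℝ) :
    Matrix (∀ i, S i) (∀ i, S i) ℝ :=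
  Matrix.of fun s s' =>
    ∑ i, Q i (s i) (s' i) * ∏ j ∈ Finset.univ.erase i, (1 : Matrix (S j) (S j) ℝ) (s j) (s' j)

/-- A road network on the node set `N`, with the data of its velocity model. -/
structure RoadNetwork (N : Type*) where
  /-- the directed arcs -/
  arcs : Finset (N × N)
  /-- the length of each arc -/
  length : arcs → ℝ
  length_nonneg : ∀ a, 0 ≤ length a
  /-- the number of congestion levels of each arc -/
  levels : arcs → ℕ
  /-- the transition rate matrix of the congestion level of each arc -/
  rate : ∀ a, Matrix (Fin (levels a)) (Fin (levels a)) ℝ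
  rate_isRateMatrix : ∀ a, IsRateMatrix (rate a)
  /-- the velocity on each arc, as a function of the congestion levels of all arcs -/
  velocity : arcs → (∀ b, Fin (levels b)) → ℝ
  velocity_pos : ∀ a s, 0 < velocity a s

namespace RoadNetwork

variable {N : Type*} (net : RoadNetwork N)

/-- The states of the background process: one congestion level for every arc. -/
abbrev State : Type _ := ∀ a : net.arcs, Fin (net.levels a)

/-- The transition rate matrix `Q` of the background process. -/
def Q [DecidableEq N] : Matrix net.State net.State ℝ := kroneckerSum net.rate

/-- The diagonal matrix of the velocities on arc `a`. -/
def V [DecidableEq N] (a : net.arcs) : Matrix net.State net.State ℝ :=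
  Matrix.diagonal (net.velocity a)

/-- The background process `B(t)`, assembled from the congestion levels of the arcs. -/
def background {Ω : Type*} (X : ∀ a : net.arcs, ℝ≥0 → Ω → Fin (net.levels a))
    (t : ℝ≥0) (ω : Ω) : net.State :=
  fun a => X a t ω

/-- The congestion levels of the arcs are independent Markov processes with the rate matrices
of the network. -/
structure IsCongestionProcess {Ω : Type*} [MeasurableSpace Ω] (P : Measure Ω)
    (X : ∀ a : net.arcs, ℝ≥0 → Ω → Fin (net.levels a)) : Prop where
  markov : ∀ a, IsMarkovProcess P (net.rate a) (X a)
  indep : iIndepFun (fun a (ω : Ω) (t : ℝ≥0) => X a t ω) P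

/-- The times at which a vehicle that enters arc `a` at time `0` has traveled at least the
distance `d`, in the outcome `ω`. -/
def traveledTimes {Ω : Type*} (X : ∀ a : net.arcs, ℝ≥0 → Ω → Fin (net.levels a))
    (a : net.arcs) (d : ℝ) (ω : Ω) : Set ℝ≥0 :=
  {t | d ≤ ∫ u in (0 : ℝ)..t, net.velocity a (net.background X u.toNNReal ω)}

/-- The time needed to travel the distance `d` on arc `a`, entered at time `0`. -/
noncomputable def travelTime {Ω : Type*}
    (X : ∀ a : net.arcs, ℝ≥0 → Ω → Fin (net.levels a)) (a : net.arcs) (d : ℝ) (ω : Ω) : ℝ≥0 :=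
  sInf (net.traveledTimes X a d ω)

end RoadNetwork

open Filter Topology

/-! Put `L = V⁻¹ Q` and `W x i = exp(x L) i s'`. Since `V L = Q`, the function `W` solves the
backward equation `v i * W' x i = ∑ j, Q i j * W x j`. Let `D t` be the distance traveled up to `t`,
and consider `M t = W (d - D t) (B t)`. Over a short time, jumps of `B` contribute the drift `Q W`
and the shrinking of `d - D t` contributes `-v W'`; these cancel, so `M` is a martingale. At `τ` the
distance is exactly `d`, so `M τ = W 0 (B τ)` is the indicator of `B τ = s'`, while on `B 0 = s` the
start value is `W d s = exp(d L) s s'`. Optional stopping gives the formula.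

Only the infinitesimal description of the arcs is given, so the martingale property is used as
follows: on an event of the history up to `t`, the mean increment of `M` over `[t, t + h]` is
`o(h)`, uniformly in `t` (`HasLocalRates.abs_setIntegral_increment_le`). Stopping at the first grid
point not before `τ`, a sum of `O(1/h)` increments is `o(1)`; right-continuity lets the mesh tend to
zero (`HasLocalRates.setIntegral_stopped_eq`).

The background process has local rates `Q` because, by independence, its transition probabilities
over `h` are products of those of the arcs, and the Kronecker sum is the first-order term of `∏ (1 +
h Q_a)` (`hasLocalRates_kroneckerSum`). -/

/-- The process `B` has local transition rates `Q`: uniformly in `t`, and independently of the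
history up to time `t`, it moves from `i` to `j` during `(t, t + h]` with probability
`1{i = j} + h * Q i j + o(h)`. -/
def HasLocalRates {Ω S : Type*} [MeasurableSpace Ω] [DecidableEq S] [MeasurableSpace S]
    (P : Measure Ω) (Q : Matrix S S ℝ) (B : ℝ≥0 → Ω → S) : Prop :=
  ∀ ε : ℝ, 0 < ε → ∀ᶠ h : ℝ≥0 in 𝓝[>] 0, ∀ (t : ℝ≥0) (i j : S), ∃ p : ℝ,
    |p - ((1 : Matrix S S ℝ) i j + (h : ℝ) * Q i j)| ≤ ε * (h : ℝ) ∧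
      ∀ H : Set Ω, MeasurableSet[history B t] H →
        P.real (H ∩ ({ω | B t ω = i} ∩ {ω | B (t + h) ω = j})) = p * P.real (H ∩ {ω | B t ω = i})

/-! ### Histories and the local rates of a single Markov process -/

theorem history_le {Ω S : Type*} [mΩ : MeasurableSpace Ω] [MeasurableSpace S] {B : ℝ≥0 → Ω → S}
    (hB : ∀ t, Measurable (B t)) (t : ℝ≥0) : history B t ≤ mΩ :=
  iSup₂_le fun u _ => (hB u).comap_le

theorem history_mono {Ω S : Type*} [MeasurableSpace S] (B : ℝ≥0 → Ω → S) :
    Monotone (history B) := fun _ _ htr =>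
  iSup₂_le fun _ hu => le_iSup₂_of_le _ (Set.mem_Iic.2 (hu.trans htr)) le_rfl

theorem measurable_history {Ω S : Type*} [MeasurableSpace S] (B : ℝ≥0 → Ω → S)
    {u t : ℝ≥0} (hut : u ≤ t) : Measurable[history B t] (B u) :=
  Measurable.of_comap_le (le_iSup₂_of_le u hut le_rfl)

/-- The factor `p` is the conditional transition probability. If the present state is null, both
sides of the product identity vanish and the first-order value itself serves as `p`; the product
form thus avoids conditioning on null events. -/
theorem IsMarkovProcess.hasLocalRates {Ω : Type*} [MeasurableSpace Ω] {P : Measure Ω}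
    [IsProbabilityMeasure P] {n : ℕ} {Q : Matrix (Fin n) (Fin n) ℝ} {X : ℝ≥0 → Ω → Fin n}
    (hX : IsMarkovProcess P Q X) : HasLocalRates P Q X := by
  intro ε hε
  obtain ⟨δ, hδ, hrate⟩ := hX.rates ε hε
  filter_upwards [Ioo_mem_nhdsGT hδ] with h hh t i j
  by_cases hi : P {ω | X t ω = i} = 0
  · refine ⟨(1 : Matrix (Fin n) (Fin n) ℝ) i j + h * Q i j, ?_, fun H _ => ?_⟩
    · simpa using mul_nonneg hε.le h.2
    have h1 : P (H ∩ {ω | X t ω = i}) = 0 := measure_mono_null Set.inter_subset_right hi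
    have h2 : P (H ∩ ({ω | X t ω = i} ∩ {ω | X (t + h) ω = j})) = 0 :=
      measure_mono_null (fun ω hω => hω.2.1) hi
    simp [Measure.real, h1, h2]
  · refine ⟨_, hrate t h hh.1 hh.2 i j hi, fun H hH => ?_⟩
    have hHm : MeasurableSet (H ∩ {ω | X t ω = i}) :=
      (history_le hX.measurable t H hH).inter (hX.measurable t (measurableSet_singleton i))
    by_cases h0 : P (H ∩ {ω | X t ω = i}) = 0
    · have h2 : P (H ∩ ({ω | X t ω = i} ∩ {ω | X (t + h) ω = j})) = 0 :=
        measure_mono_null (Set.inter_subset_inter_right _ Set.inter_subset_left) h0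
      simp [Measure.real, h0, h2]
    · rw [← hX.markov t h H hH i j h0, cond_apply hHm, ENNReal.toReal_mul, ENNReal.toReal_inv,
        Set.inter_assoc]
      have h3 : (P (H ∩ {ω | X t ω = i})).toReal ≠ 0 :=
        (ENNReal.toReal_pos h0 (measure_ne_top _ _)).ne'
      simp only [Measure.real]
      field_simp

/-! ### Independent components and the Kronecker sum -/

theorem history_pi {Ω ι : Type*} {S : ι → Type*} [∀ a, MeasurableSpace (S a)]
    (X : ∀ a, ℝ≥0 → Ω → S a) (t : ℝ≥0) :
    history (fun u ω a => X a u ω) t = ⨆ a, history (X a) t := by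
  have h : ∀ u, MeasurableSpace.comap (fun ω a => X a u ω) MeasurableSpace.pi =
      ⨆ a, MeasurableSpace.comap (X a u) inferInstance := fun u => by
    simp only [MeasurableSpace.pi, MeasurableSpace.comap_iSup, MeasurableSpace.comap_comp,
      Function.comp_def]
  simp only [history, h]
  refine le_antisymm ?_ ?_
  · exact iSup₂_le fun u hu => iSup_le fun a => le_iSup_of_le a (le_iSup₂_of_le u hu le_rfl)
  · exact iSup_le fun a => iSup₂_le fun u hu => le_iSup₂_of_le u hu (le_iSup_of_le a le_rfl)

theorem eventually_abs_prod_sub_le {ι : Type*} [Fintype ι] [DecidableEq ι] (e : ι → ℝ) {ε : ℝ}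
    (hε : 0 < ε) : ∀ᶠ x : ι → ℝ in 𝓝 e,
      |∏ a, x a - ∏ a, e a - ∑ a, (x a - e a) * ∏ b ∈ Finset.univ.erase a, e b|
        ≤ ε * ‖x - e‖ := by
  have h := (hasFDerivAt_finsetProd (𝕜 := ℝ) (𝔸' := ℝ) (u := Finset.univ)
    (x := e)).isLittleO.bound hε
  filter_upwards [h] with x hx
  simpa [Real.norm_eq_abs, _root_.sum_apply, mul_comm] using hx

theorem prod_one_apply {ι : Type*} [Fintype ι] {S : ι → Type*} [∀ a, DecidableEq (S a)]
    (s s' : ∀ a, S a) :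
    ∏ a, (1 : Matrix (S a) (S a) ℝ) (s a) (s' a) = (1 : Matrix (∀ a, S a) (∀ a, S a) ℝ) s s' := by
  classical
  simp [Matrix.one_apply, Finset.prod_ite_zero, funext_iff]

/-- Differentiating the product of the entries at the identity matrices, one factor at a time,
produces the terms of the Kronecker sum. Finiteness of the state spaces makes the remainder uniform.
-/
theorem eventually_abs_prod_sub_kroneckerSum_le {ι : Type*} [Fintype ι] [DecidableEq ι]
    {S : ι → Type*} [∀ a, DecidableEq (S a)] [∀ a, Fintype (S a)]
    (Q : ∀ a, Matrix (S a) (S a) ℝ) {ε : ℝ} (hε : 0 < ε) :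
    ∃ η : ℝ, 0 < η ∧ ∀ᶠ h : ℝ≥0 in 𝓝[>] 0, ∀ (s s' : ∀ a, S a) (p : ι → ℝ),
      (∀ a, |p a - ((1 : Matrix (S a) (S a) ℝ) (s a) (s' a) + (h : ℝ) * Q a (s a) (s' a))|
        ≤ η * h) →
      |∏ a, p a - ((1 : Matrix (∀ a, S a) (∀ a, S a) ℝ) s s' + h * kroneckerSum Q s s')|
        ≤ ε * h := by
  obtain ⟨c, hc⟩ : ∃ c : ℝ, ∀ (s s' : ∀ a, S a) a, |Q a (s a) (s' a)| ≤ c := by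
    obtain ⟨c, hc⟩ := (Set.finite_range fun x : (∀ a, S a) × (∀ a, S a) × ι =>
      |Q x.2.2 (x.1 x.2.2) (x.2.1 x.2.2)|).bddAbove
    exact ⟨c, fun s s' a => hc ⟨(s, s', a), rfl⟩⟩
  -- Half of `ε` pays for the errors `η * h` of all factors together, half for the Taylor remainder
  -- of the product. The cap `1` keeps the deviation from the identity entries below `(|c| + 1) *
  -- h`.
  set η : ℝ := min 1 (ε / (2 * (Fintype.card ι + 1))) with hη
  have hη0 : 0 < η := by positivity
  have hη1 : η ≤ 1 := min_le_left _ _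
  have hη2 : Fintype.card ι * η ≤ ε / 2 := by
    have : η ≤ ε / (2 * (Fintype.card ι + 1)) := min_le_right _ _
    rw [le_div_iff₀ (by positivity)] at this
    nlinarith
  have hK : 0 < |c| + 1 := by positivity
  have hev : ∀ᶠ r : ℝ in 𝓝 0, ∀ s s' : ∀ a, S a, ∀ x : ι → ℝ,
      ‖x - fun a => (1 : Matrix (S a) (S a) ℝ) (s a) (s' a)‖ ≤ r →
      |∏ a, x a - ∏ a, (1 : Matrix (S a) (S a) ℝ) (s a) (s' a) -
        ∑ a, (x a - (1 : Matrix (S a) (S a) ℝ) (s a) (s' a)) *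
          ∏ b ∈ Finset.univ.erase a, (1 : Matrix (S b) (S b) ℝ) (s b) (s' b)|
        ≤ ε / (2 * (|c| + 1)) * ‖x - fun a => (1 : Matrix (S a) (S a) ℝ) (s a) (s' a)‖ := by
    rw [eventually_all]
    intro s
    rw [eventually_all]
    intro s'
    obtain ⟨ρ, hρ, h⟩ := Metric.eventually_nhds_iff.1 (eventually_abs_prod_sub_le
      (fun a => (1 : Matrix (S a) (S a) ℝ) (s a) (s' a))
      (show 0 < ε / (2 * (|c| + 1)) by positivity))
    filter_upwards [gt_mem_nhds hρ] with r hr x hx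
    exact h (by rw [dist_eq_norm]; exact hx.trans_lt hr)
  have htend : Tendsto (fun h : ℝ≥0 => (|c| + 1) * (h : ℝ)) (𝓝[>] 0) (𝓝 0) := by
    have : Continuous fun h : ℝ≥0 => (|c| + 1) * (h : ℝ) := by fun_prop
    simpa using this.tendsto 0 |>.mono_left nhdsWithin_le_nhds
  refine ⟨η, hη0, ?_⟩
  filter_upwards [htend.eventually hev] with h hh s s' p hp
  have hx : ‖p - fun a => (1 : Matrix (S a) (S a) ℝ) (s a) (s' a)‖ ≤ (|c| + 1) * h := by
    refine (pi_norm_le_iff_of_nonneg (by positivity)).2 fun a => ?_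
    have h1 := hp a
    have h2 : |(h : ℝ) * Q a (s a) (s' a)| ≤ h * |c| := by
      rw [abs_mul, abs_of_nonneg (NNReal.coe_nonneg h)]
      exact mul_le_mul_of_nonneg_left ((hc s s' a).trans (le_abs_self c)) h.2
    have h3 : η * h ≤ 1 * h := mul_le_mul_of_nonneg_right hη1 h.2
    simp only [Pi.sub_apply, Real.norm_eq_abs]
    rw [abs_le] at *
    constructor <;> linarith [h1.1, h1.2, h2.1, h2.2]
  have h1 := hh s s' p hx
  have h2 : ε / (2 * (|c| + 1)) * ‖p - fun a => (1 : Matrix (S a) (S a) ℝ) (s a) (s' a)‖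
      ≤ ε / 2 * h := by
    calc _ ≤ ε / (2 * (|c| + 1)) * ((|c| + 1) * h) := by gcongr
      _ = _ := by field_simp
  have h3 : |∑ a, (p a - ((1 : Matrix (S a) (S a) ℝ) (s a) (s' a) + h * Q a (s a) (s' a))) *
      ∏ b ∈ Finset.univ.erase a, (1 : Matrix (S b) (S b) ℝ) (s b) (s' b)| ≤ ε / 2 * h := by
    calc _ ≤ ∑ a : ι, η * h := by
          refine (Finset.abs_sum_le_sum_abs _ _).trans (Finset.sum_le_sum fun a _ => ?_)
          rw [abs_mul]
          have : |∏ b ∈ Finset.univ.erase a, (1 : Matrix (S b) (S b) ℝ) (s b) (s' b)| ≤ 1 := by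
            rw [Finset.abs_prod]
            refine Finset.prod_le_one (fun _ _ => abs_nonneg _) fun b _ => ?_
            rw [Matrix.one_apply]
            split_ifs <;> simp
          calc _ ≤ (η * h) * 1 := by gcongr; exact hp a
            _ = _ := mul_one _
      _ = Fintype.card ι * η * h := by simp [mul_assoc]
      _ ≤ _ := mul_le_mul_of_nonneg_right hη2 h.2
  have h4 : ∏ a, p a - ((1 : Matrix (∀ a, S a) (∀ a, S a) ℝ) s s' + h * kroneckerSum Q s s') =
      (∏ a, p a - ∏ a, (1 : Matrix (S a) (S a) ℝ) (s a) (s' a) -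
        ∑ a, (p a - (1 : Matrix (S a) (S a) ℝ) (s a) (s' a)) *
          ∏ b ∈ Finset.univ.erase a, (1 : Matrix (S b) (S b) ℝ) (s b) (s' b)) +
      ∑ a, (p a - ((1 : Matrix (S a) (S a) ℝ) (s a) (s' a) + h * Q a (s a) (s' a))) *
        ∏ b ∈ Finset.univ.erase a, (1 : Matrix (S b) (S b) ℝ) (s b) (s' b) := by
    rw [prod_one_apply, kroneckerSum, Matrix.of_apply, Finset.mul_sum, sub_add,
      ← Finset.sum_sub_distrib, sub_sub]
    congr 2
    refine Finset.sum_congr rfl fun a _ => ?_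
    ring
  rw [h4]
  calc _ ≤ _ := abs_add_le _ _
    _ ≤ ε / 2 * h + ε / 2 * h := add_le_add (h1.trans h2) h3
    _ = ε * h := by ring

theorem trim_restrict_apply_eq_iff {Ω : Type*} {m mΩ : MeasurableSpace Ω} {P : Measure Ω}
    [IsFiniteMeasure P] (hm : m ≤ mΩ) {E F : Set Ω} {p : ℝ} (hp : 0 ≤ p)
    {H : Set Ω} (hH : MeasurableSet[m] H) :
    ((P.restrict E).trim hm) H = (ENNReal.ofReal p • (P.restrict F).trim hm) H ↔
      P.real (H ∩ E) = p * P.real (H ∩ F) := by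
  rw [Measure.smul_apply, trim_measurableSet_eq hm hH, trim_measurableSet_eq hm hH,
    Measure.restrict_apply (hm _ hH), Measure.restrict_apply (hm _ hH), smul_eq_mul,
    ← ENNReal.toReal_eq_toReal_iff' (measure_ne_top _ _)
      (ENNReal.mul_ne_top ENNReal.ofReal_ne_top (measure_ne_top _ _)), ENNReal.toReal_mul,
    ENNReal.toReal_ofReal hp]
  rfl

/-- For `p ≥ 0` both sides are finite measures in `H` on `m`, so agreement on a generating π-system
that contains the whole space suffices. -/
theorem measureReal_inter_eq_mul_of_generateFrom {Ω : Type*} {m mΩ : MeasurableSpace Ω}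
    {P : Measure Ω} [IsFiniteMeasure P] (hm : m ≤ mΩ) {C : Set (Set Ω)}
    (hgen : m = MeasurableSpace.generateFrom C) (hC : IsPiSystem C) (huniv : Set.univ ∈ C)
    {E F : Set Ω} {p : ℝ} (hp : 0 ≤ p)
    (h : ∀ H ∈ C, P.real (H ∩ E) = p * P.real (H ∩ F)) {H : Set Ω} (hH : MeasurableSet[m] H) :
    P.real (H ∩ E) = p * P.real (H ∩ F) := by
  have hCm : ∀ H ∈ C, MeasurableSet[m] H := fun H hH => by
    rw [hgen]; exact MeasurableSpace.measurableSet_generateFrom hH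
  have heq : (P.restrict E).trim hm = ENNReal.ofReal p • (P.restrict F).trim hm :=
    ext_of_generate_finite C hgen hC
      (fun H hH => (trim_restrict_apply_eq_iff hm hp (hCm H hH)).2 (h H hH))
      ((trim_restrict_apply_eq_iff hm hp (hCm _ huniv)).2 (h _ huniv))
  exact (trim_restrict_apply_eq_iff hm hp hH).1 (by rw [heq])

/-- The hypothesis says that two measures coincide on `m`, hence so do integrals of `m`-measurable
functions. The sign of `p` is forced unless `F` is null, and then both integrals are zero. -/
theorem setIntegral_eq_mul_of_measureReal_inter {Ω : Type*} {m mΩ : MeasurableSpace Ω}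
    {P : Measure Ω} [IsFiniteMeasure P] (hm : m ≤ mΩ)
    {E F : Set Ω} {p : ℝ}
    (h : ∀ H, MeasurableSet[m] H → P.real (H ∩ E) = p * P.real (H ∩ F)) {f : Ω → ℝ}
    (hf : Measurable[m] f) : ∫ ω in E, f ω ∂P = p * ∫ ω in F, f ω ∂P := by
  have hu := h Set.univ MeasurableSet.univ
  simp only [Set.univ_inter] at hu
  by_cases hF : P.real F = 0
  · rw [hF, mul_zero] at hu
    rw [setIntegral_measure_zero _ ((measureReal_eq_zero_iff).1 hu),
      setIntegral_measure_zero _ ((measureReal_eq_zero_iff).1 hF), mul_zero]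
  · have hp : 0 ≤ p := by
      have h1 : 0 < P.real F := lt_of_le_of_ne measureReal_nonneg (Ne.symm hF)
      have h2 : 0 ≤ p * P.real F := hu ▸ measureReal_nonneg
      exact nonneg_of_mul_nonneg_left h2 h1
    have heq : (P.restrict E).trim hm = ENNReal.ofReal p • (P.restrict F).trim hm :=
      @Measure.ext _ m _ _ fun H hH => (trim_restrict_apply_eq_iff hm hp hH).2 (h H hH)
    rw [integral_trim hm hf.stronglyMeasurable, heq, integral_smul_measure,
      ← integral_trim hm hf.stronglyMeasurable, ENNReal.toReal_ofReal hp, smul_eq_mul]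

/-- The joint history is generated by the π-system of finite intersections of events from the
histories of the components. On such an intersection independence factors both sides, and the
identities of the components multiply. -/
theorem hasLocalRates_kroneckerSum {Ω ι : Type*} [MeasurableSpace Ω] {P : Measure Ω}
    [IsProbabilityMeasure P] [Fintype ι] [DecidableEq ι] {S : ι → Type*}
    [∀ a, DecidableEq (S a)] [∀ a, Fintype (S a)] [∀ a, MeasurableSpace (S a)]
    [∀ a, MeasurableSingletonClass (S a)] {Q : ∀ a, Matrix (S a) (S a) ℝ}
    {X : ∀ a, ℝ≥0 → Ω → S a} (hmeas : ∀ a t, Measurable (X a t))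
    (hX : ∀ a, HasLocalRates P (Q a) (X a))
    (hind : iIndepFun (fun a ω (t : ℝ≥0) => X a t ω) P) :
    HasLocalRates P (kroneckerSum Q) (fun t ω a => X a t ω) := by
  intro ε hε
  obtain ⟨η, hη, hev⟩ := eventually_abs_prod_sub_kroneckerSum_le Q hε
  filter_upwards [hev, eventually_all.2 fun a => hX a η hη] with h hh hX t i j
  have hB : ∀ u i, {ω | (fun a => X a u ω) = i} = ⋂ a, {ω | X a u ω = i a} := by
    intro u i; ext ω; simp [funext_iff]
  have hBm : ∀ u, Measurable fun ω a => X a u ω := fun u =>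
    measurable_pi_lambda _ fun a => hmeas a u
  by_cases h0 : P {ω | (fun a => X a t ω) = i} = 0
  · refine ⟨(1 : Matrix (∀ a, S a) (∀ a, S a) ℝ) i j + h * kroneckerSum Q i j, ?_, fun H _ => ?_⟩
    · simpa using mul_nonneg hε.le h.2
    have h1 : P (H ∩ {ω | (fun a => X a t ω) = i}) = 0 :=
      measure_mono_null Set.inter_subset_right h0
    have h2 : P (H ∩ ({ω | (fun a => X a t ω) = i} ∩ {ω | (fun a => X a (t + h) ω) = j})) = 0 :=
      measure_mono_null (fun ω hω => hω.2.1) h0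
    simp [Measure.real, h1, h2]
  choose p hp hpH using fun a => hX a t (i a) (j a)
  -- Needed to compare measures. Each `p a` is a genuine ratio, since the event of the present joint
  -- state has positive probability and lies in that of its component.
  have hp0 : ∀ a, 0 ≤ p a := by
    intro a
    have h1 := hpH a Set.univ MeasurableSet.univ
    rw [Set.univ_inter, Set.univ_inter] at h1
    have h2 : 0 < P.real {ω | X a t ω = i a} := by
      refine ENNReal.toReal_pos (fun h3 => h0 (measure_mono_null ?_ h3)) (measure_ne_top _ _)
      rintro ω rfl
      rfl
    by_contra! h3
    have := mul_neg_of_neg_of_pos h3 h2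
    linarith [measureReal_nonneg (μ := P) (s := {ω | X a t ω = i a} ∩ {ω | X a (t + h) ω = j a})]
  refine ⟨∏ a, p a, hh i j p hp, fun H hH => ?_⟩
  -- Independence is stated for whole paths, whose sigma-algebra contains both past and future
  -- events.
  have hle : ∀ a u, history (X a) u ≤
      MeasurableSpace.comap (fun ω (t : ℝ≥0) => X a t ω) MeasurableSpace.pi := by
    intro a u
    refine iSup₂_le fun r _ => ?_
    have : X a r = (fun f : ℝ≥0 → S a => f r) ∘ (fun ω (t : ℝ≥0) => X a t ω) := rfl
    rw [this, ← MeasurableSpace.comap_comp]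
    exact MeasurableSpace.comap_mono (measurable_pi_apply r).comap_le
  have hst : ∀ a u k, MeasurableSet[MeasurableSpace.comap (fun ω (t : ℝ≥0) => X a t ω)
      MeasurableSpace.pi] {ω | X a u ω = k} := fun a u k =>
    hle a u _ (measurable_history (X a) le_rfl (measurableSet_singleton k))
  refine measureReal_inter_eq_mul_of_generateFrom (history_le hBm t)
    (C := piiUnionInter (fun a => {s | MeasurableSet[history (X a) t] s}) Set.univ) ?_
    (isPiSystem_piiUnionInter _ (fun a => @MeasurableSpace.isPiSystem_measurableSet _ (_)) _)
    ⟨∅, by simp, fun _ => Set.univ, by simp, by simp⟩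
    (Finset.prod_nonneg fun a _ => hp0 a) ?_ hH
  · rw [generateFrom_piiUnionInter_measurableSet (fun a => history (X a) t), history_pi]
    simp
  · rintro _ ⟨T, -, f, hf, rfl⟩
    classical
    -- Padding with the whole space makes the intersection run over all components.
    set g : ι → Set Ω := fun a => if a ∈ T then f a else Set.univ with hg
    have hgm : ∀ a, MeasurableSet[history (X a) t] (g a) := by
      intro a
      by_cases ha : a ∈ T
      · simpa [hg, ha] using hf a ha
      · simp [hg, ha]
    have hT : (⋂ x ∈ T, f x) = ⋂ a, g a := by
      ext ω
      simp only [hg, Set.mem_iInter]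
      refine forall_congr' fun a => ?_
      by_cases ha : a ∈ T <;> simp [ha]
    rw [hT, hB, hB, ← Set.iInter_inter_distrib, ← Set.iInter_inter_distrib,
      ← Set.iInter_inter_distrib, Measure.real, Measure.real,
      hind.meas_iInter fun a => (hle a t _ (hgm a)).inter ((hst a _ _).inter (hst a _ _)),
      hind.meas_iInter fun a => (hle a t _ (hgm a)).inter (hst a _ _), ENNReal.toReal_prod,
      ENNReal.toReal_prod, ← Finset.prod_mul_distrib]
    exact Finset.prod_congr rfl fun a _ => hpH a (g a) (hgm a)

/-! ### Measurability of right-continuous processes -/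

theorem tendsto_floor_add_one_div (u : ℝ≥0) :
    Tendsto (fun n : ℕ => ((⌊u * (n + 1)⌋₊ : ℝ≥0) + 1) / (n + 1)) atTop (𝓝[≥] u) := by
  have hlow : ∀ n : ℕ, u ≤ ((⌊u * (n + 1)⌋₊ : ℝ≥0) + 1) / (n + 1) := fun n => by
    rw [le_div_iff₀ (by positivity)]
    exact (Nat.lt_floor_add_one _).le
  refine tendsto_nhdsWithin_iff.2 ⟨?_, Eventually.of_forall hlow⟩
  have hup : ∀ n : ℕ, ((⌊u * (n + 1)⌋₊ : ℝ≥0) + 1) / (n + 1) ≤ u + 1 / ((n : ℝ≥0) + 1) := fun n => by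
    rw [add_div]
    gcongr
    rw [div_le_iff₀ (by positivity)]
    exact Nat.floor_le zero_le
  refine tendsto_of_tendsto_of_tendsto_of_le_of_le tendsto_const_nhds ?_ hlow hup
  simpa using (tendsto_one_div_add_atTop_nhds_zero_nat (𝕜 := ℝ≥0)).const_add u

theorem exists_measurable_approx_from_right : ∃ (q : ℕ → ℕ → ℝ≥0) (k : ℕ → ℝ≥0 → ℕ),
    (∀ n, Measurable (k n)) ∧ ∀ u, Tendsto (fun n => q n (k n u)) atTop (𝓝[≥] u) :=
  ⟨fun n k => ((k : ℝ≥0) + 1) / (n + 1), fun n u => ⌊u * (n + 1)⌋₊,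
    fun _ => Nat.measurable_floor.comp (measurable_id.mul_const _), tendsto_floor_add_one_div⟩

/-- A right-continuous process is jointly measurable. -/
theorem measurable_uncurry_of_right_continuous {Ω E : Type*} [MeasurableSpace Ω]
    [TopologicalSpace E] [TopologicalSpace.PseudoMetrizableSpace E] [MeasurableSpace E]
    [BorelSpace E] {f : ℝ≥0 → Ω → E} (hf : ∀ u, Measurable (f u))
    (hc : ∀ ω u, ContinuousWithinAt (fun r => f r ω) (Set.Ici u) u) :
    Measurable (Function.uncurry f) := by
  obtain ⟨q, k, hk, hq⟩ := exists_measurable_approx_from_right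
  -- Sampling the time at a grid point to its right leaves a countable time index, for which joint
  -- measurability is automatic.
  have h1 : ∀ n, Measurable fun y : ℕ × Ω => f (q n y.1) y.2 := fun n =>
    measurable_from_prod_countable_right fun i => hf (q n i)
  refine measurable_of_tendsto_metrizable
    (fun n => (h1 n).comp (((hk n).comp measurable_fst).prodMk measurable_snd))
    (tendsto_pi_nhds.2 fun x => ?_)
  exact (hc x.2 x.1).tendsto.comp (hq x.1)

theorem measurable_of_right_continuous {E : Type*} [TopologicalSpace E]
    [TopologicalSpace.PseudoMetrizableSpace E] [MeasurableSpace E] [BorelSpace E] {g : ℝ≥0 → E}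
    (hc : ∀ u, ContinuousWithinAt g (Set.Ici u) u) : Measurable g :=
  (measurable_uncurry_of_right_continuous (Ω := Unit) (f := fun u _ => g u)
    (fun _ => measurable_const) fun _ u => hc u).comp (measurable_id.prodMk (measurable_const (a := ())))

/-! ### Distance traveled along one path -/

/-- The distance traveled up to time `t` at the speed `g`. -/
noncomputable def traveledDistance (g : ℝ≥0 → ℝ) (t : ℝ≥0) : ℝ :=
  ∫ u in (0 : ℝ)..t, g u.toNNReal

section Path

variable {g : ℝ≥0 → ℝ} {c C : ℝ}

theorem intervalIntegrable_of_right_continuous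
    (hg : ∀ u, ContinuousWithinAt g (Set.Ici u) u) (hC : ∀ u, |g u| ≤ C) (a b : ℝ) :
    IntervalIntegrable (fun u : ℝ => g u.toNNReal) volume a b := by
  rw [intervalIntegrable_iff]
  refine Measure.integrableOn_of_bounded (M := C) (by simp)
    ((measurable_of_right_continuous hg).comp measurable_real_toNNReal).aestronglyMeasurable
    (ae_of_all _ fun u => hC _)

theorem traveledDistance_sub (hg : ∀ u, ContinuousWithinAt g (Set.Ici u) u)
    (hC : ∀ u, |g u| ≤ C) (t r : ℝ≥0) :
    traveledDistance g r - traveledDistance g t = ∫ u in (t : ℝ)..r, g u.toNNReal :=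
  intervalIntegral.integral_interval_sub_left (intervalIntegrable_of_right_continuous hg hC _ _)
    (intervalIntegrable_of_right_continuous hg hC _ _)

theorem abs_traveledDistance_sub_le (hg : ∀ u, ContinuousWithinAt g (Set.Ici u) u)
    (hC : ∀ u, |g u| ≤ C) (t r : ℝ≥0) :
    |traveledDistance g r - traveledDistance g t| ≤ C * |(r : ℝ) - t| := by
  rw [traveledDistance_sub hg hC]
  exact intervalIntegral.norm_integral_le_of_norm_le_const (f := fun u : ℝ => g u.toNNReal)
    fun u _ => hC _

theorem mul_le_traveledDistance_sub (hg : ∀ u, ContinuousWithinAt g (Set.Ici u) u)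
    (hC : ∀ u, |g u| ≤ C) (hc : ∀ u, c ≤ g u) {t r : ℝ≥0} (htr : t ≤ r) :
    c * ((r : ℝ) - t) ≤ traveledDistance g r - traveledDistance g t := by
  rw [traveledDistance_sub hg hC]
  have h := intervalIntegral.integral_mono_on (μ := volume) (f := fun _ => c)
    (NNReal.coe_le_coe.2 htr) (by simp) (intervalIntegrable_of_right_continuous hg hC t r)
    (fun u _ => hc _)
  simpa [mul_comm] using h

theorem traveledDistance_zero (g : ℝ≥0 → ℝ) : traveledDistance g 0 = 0 := by
  simp [traveledDistance]

theorem continuous_traveledDistance (hg : ∀ u, ContinuousWithinAt g (Set.Ici u) u)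
    (hC : ∀ u, |g u| ≤ C) : Continuous (traveledDistance g) := by
  refine (LipschitzWith.of_dist_le_mul (K := C.toNNReal) fun r t => ?_).continuous
  rw [Real.dist_eq, NNReal.dist_eq, Real.coe_toNNReal _ ((abs_nonneg _).trans (hC 0))]
  exact abs_traveledDistance_sub_le hg hC t r

theorem monotone_traveledDistance (hg : ∀ u, ContinuousWithinAt g (Set.Ici u) u)
    (hC : ∀ u, |g u| ≤ C) (h0 : ∀ u, 0 ≤ g u) : Monotone (traveledDistance g) := fun t r htr => by
  have := mul_le_traveledDistance_sub hg hC h0 htr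
  linarith

theorem le_traveledDistance_of_div_le (hg : ∀ u, ContinuousWithinAt g (Set.Ici u) u)
    (hC : ∀ u, |g u| ≤ C) (hc0 : 0 < c) (hc : ∀ u, c ≤ g u) {d : ℝ} {t : ℝ≥0} (ht : d / c ≤ t) :
    d ≤ traveledDistance g t := by
  have h := mul_le_traveledDistance_sub hg hC hc (zero_le (a := t))
  rw [traveledDistance_zero] at h
  rw [div_le_iff₀ hc0] at ht
  simp only [NNReal.coe_zero, sub_zero] at h
  linarith

/-- Continuity of the distance makes the set closed; the speed bound `c` from below makes it
nonempty, with witness `d / c`. -/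
theorem isLeast_sInf_traveledDistance (hg : ∀ u, ContinuousWithinAt g (Set.Ici u) u)
    (hC : ∀ u, |g u| ≤ C) (hc0 : 0 < c) (hc : ∀ u, c ≤ g u) (d : ℝ) :
    IsLeast {t | d ≤ traveledDistance g t} (sInf {t | d ≤ traveledDistance g t}) := by
  refine ⟨(isClosed_le continuous_const (continuous_traveledDistance hg hC)).csInf_mem
    ⟨(d / c).toNNReal, ?_⟩ (OrderBot.bddBelow _), fun t ht => csInf_le (OrderBot.bddBelow _) ht⟩
  exact le_traveledDistance_of_div_le hg hC hc0 hc (Real.le_coe_toNNReal _)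

theorem traveledDistance_lt_iff (hg : ∀ u, ContinuousWithinAt g (Set.Ici u) u)
    (hC : ∀ u, |g u| ≤ C) (h0 : ∀ u, 0 ≤ g u) {d : ℝ} {τ : ℝ≥0}
    (hτ : IsLeast {t | d ≤ traveledDistance g t} τ) (t : ℝ≥0) :
    traveledDistance g t < d ↔ t < τ := by
  refine ⟨fun h => ?_, fun h => ?_⟩
  · by_contra! h1
    exact absurd (hτ.1.trans (monotone_traveledDistance hg hC h0 h1)) (not_le.2 h)
  · by_contra! h1
    exact absurd (hτ.2 h1) (not_le.2 h)

theorem traveledDistance_eq (hg : ∀ u, ContinuousWithinAt g (Set.Ici u) u)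
    (hC : ∀ u, |g u| ≤ C) (h0 : ∀ u, 0 ≤ g u) {d : ℝ} (hd : 0 ≤ d) {τ : ℝ≥0}
    (hτ : IsLeast {t | d ≤ traveledDistance g t} τ) : traveledDistance g τ = d := by
  refine le_antisymm ?_ hτ.1
  rcases eq_or_ne τ 0 with rfl | h
  · rwa [traveledDistance_zero]
  -- The distance is below `d` before `τ`; pass to the limit from the left.
  · have : (𝓝[<] τ).NeBot := nhdsLT_neBot_of_exists_lt ⟨0, pos_iff_ne_zero.2 h⟩
    refine le_of_tendsto (((continuous_traveledDistance hg hC).tendsto τ).mono_left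
      (nhdsWithin_le_nhds (s := Set.Iio τ))) ?_
    filter_upwards [self_mem_nhdsWithin] with t ht
    exact ((traveledDistance_lt_iff hg hC h0 hτ t).2 ht).le

end Path

/-! ### Distance traveled at a random speed -/

section RandomSpeed

variable {Ω : Type*} {G : ℝ≥0 → Ω → ℝ} {C : ℝ}

/-- Freezing the speed after `t` does not change the integral up to `t`, so only the times `u ≤ t`
enter. This allows `m` to be the history up to `t`. -/
theorem measurable_traveledDistance {m : MeasurableSpace Ω} {t : ℝ≥0}
    (hG : ∀ u ≤ t, Measurable (G u))
    (hc : ∀ ω u, ContinuousWithinAt (fun r => G r ω) (Set.Ici u) u) :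
    Measurable fun ω => traveledDistance (fun u => G u ω) t := by
  have h1 : Measurable (Function.uncurry fun (u : ℝ≥0) ω => G (min u t) ω) := by
    refine measurable_uncurry_of_right_continuous (fun u => hG _ (min_le_right _ _)) fun ω u => ?_
    refine ContinuousWithinAt.comp (g := fun r => G r ω) (f := fun r => min r t)
      (t := Set.Ici (min u t)) (hc ω _) ?_ fun r hr => min_le_min_right t hr
    exact (continuous_id.min continuous_const).continuousWithinAt
  have h2 : Measurable fun x : Ω × ℝ => G (min x.2.toNNReal t) x.1 :=
    h1.comp ((measurable_real_toNNReal.comp measurable_snd).prodMk measurable_fst)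
  have h3 : Measurable fun ω => ∫ u in Set.Ioc (0 : ℝ) t, G (min u.toNNReal t) ω :=
    (h2.stronglyMeasurable.integral_prod_right (ν := volume.restrict (Set.Ioc (0 : ℝ) t))).measurable
  convert h3 using 2 with ω
  rw [traveledDistance, intervalIntegral.integral_of_le (NNReal.coe_nonneg t)]
  refine setIntegral_congr_fun measurableSet_Ioc fun u hu => ?_
  rw [min_eq_left (Real.toNNReal_le_iff_le_coe.2 hu.2)]

theorem integral_abs_traveledDistance_sub_le [MeasurableSpace Ω] {P : Measure Ω}
    [IsFiniteMeasure P] (hG : ∀ u, Measurable (G u))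
    (hc : ∀ ω u, ContinuousWithinAt (fun r => G r ω) (Set.Ici u) u) (hC : ∀ u ω, |G u ω| ≤ C)
    {t h : ℝ≥0} {K : ℝ} (hK : ∀ u, t ≤ u → u ≤ t + h → ∫ ω, |G u ω - G t ω| ∂P ≤ K) :
    ∫ ω, |traveledDistance (fun u => G u ω) (t + h) - traveledDistance (fun u => G u ω) t
      - h * G t ω| ∂P ≤ h * K := by
  set I : Set ℝ := Set.Ioc (t : ℝ) ((t + h : ℝ≥0) : ℝ) with hI
  have hle : (t : ℝ) ≤ ((t + h : ℝ≥0) : ℝ) := NNReal.coe_le_coe.2 le_self_add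
  have hvol : volume.real I = h := by
    simp [hI]
  have hm : Measurable (Function.uncurry fun ω (u : ℝ) => |G u.toNNReal ω - G t ω|) := by
    have h1 : Measurable fun x : Ω × ℝ => G x.2.toNNReal x.1 :=
      (measurable_uncurry_of_right_continuous hG hc).comp
        ((measurable_real_toNNReal.comp measurable_snd).prodMk measurable_fst)
    exact (h1.sub ((hG t).comp measurable_fst)).abs
  have hint : Integrable (Function.uncurry fun ω (u : ℝ) => |G u.toNNReal ω - G t ω|)
      (P.prod (volume.restrict I)) := by
    have : IsFiniteMeasure (volume.restrict I) := ⟨by simp [hI]⟩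
    refine Integrable.of_bound hm.aestronglyMeasurable (C + C) (ae_of_all _ fun x => ?_)
    simp only [Function.uncurry, Real.norm_eq_abs, abs_abs]
    exact (abs_sub _ _).trans (add_le_add (hC _ _) (hC _ _))
  have hpt : ∀ ω, |traveledDistance (fun u => G u ω) (t + h) - traveledDistance (fun u => G u ω) t
      - h * G t ω| ≤ ∫ u in I, |G u.toNNReal ω - G t ω| := by
    intro ω
    have h1 : (h : ℝ) * G t ω = ∫ _ in (t : ℝ)..((t + h : ℝ≥0) : ℝ), G t ω := by simp
    rw [traveledDistance_sub (hc ω) (fun u => hC u ω), h1,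
      ← intervalIntegral.integral_sub
        (intervalIntegrable_of_right_continuous (hc ω) (fun u => hC u ω) _ _) (by simp),
      intervalIntegral.integral_of_le hle]
    exact abs_integral_le_integral_abs
  calc _ ≤ ∫ ω, (∫ u in I, |G u.toNNReal ω - G t ω|) ∂P :=
        integral_mono_of_nonneg (ae_of_all _ fun _ => abs_nonneg _) hint.integral_prod_left
          (ae_of_all _ hpt)
    _ = ∫ u in I, (∫ ω, |G u.toNNReal ω - G t ω| ∂P) := integral_integral_swap hint
    _ ≤ ∫ _ in I, K := by
        refine setIntegral_mono_on hint.integral_prod_right (by simp [hI]) measurableSet_Ioc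
          fun u hu => hK _ ?_ ?_
        · exact NNReal.le_toNNReal_of_coe_le hu.1.le
        · exact Real.toNNReal_le_iff_le_coe.2 hu.2
    _ = h * K := by rw [setIntegral_const, hvol, smul_eq_mul]

end RandomSpeed

/-! ### Jump probabilities and the drift of functions of the state -/

section

variable {Ω S : Type*} [MeasurableSpace Ω] {P : Measure Ω} [IsProbabilityMeasure P] [Fintype S]
  [DecidableEq S] [MeasurableSpace S] [MeasurableSingletonClass S] {Q : Matrix S S ℝ}
  {B : ℝ≥0 → Ω → S}

/-- From each state `i` the probability of having left is `1 - p`, with `p` within `h` of `1 + h * Q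
i i`. Summing over the states costs the factor `Fintype.card S`. -/
theorem HasLocalRates.measureReal_ne_le (hQ : HasLocalRates P Q B)
    (hB : ∀ t, Measurable (B t)) :
    ∃ C : ℝ, 0 ≤ C ∧ ∃ δ : ℝ≥0, 0 < δ ∧ ∀ t h : ℝ≥0, h < δ →
      P.real {ω | B (t + h) ω ≠ B t ω} ≤ C * h := by
  obtain ⟨c, hc⟩ : ∃ c : ℝ, ∀ i, |Q i i| ≤ c := by
    obtain ⟨c, hc⟩ := (Set.finite_range fun i => |Q i i|).bddAbove
    exact ⟨c, fun i => hc ⟨i, rfl⟩⟩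
  obtain ⟨δ, hδ, hδh⟩ := (mem_nhdsGT_iff_exists_Ioo_subset).1 (hQ 1 one_pos)
  have hc1 : 0 ≤ |c| + 1 := by positivity
  refine ⟨Fintype.card S * (|c| + 1), by positivity, δ, hδ, fun t h hh => ?_⟩
  rcases eq_or_ne h 0 with rfl | h0
  · simp
  have hpos : 0 < h := pos_iff_ne_zero.2 h0
  have key : ∀ i, P.real ({ω | B t ω = i} \ {ω | B (t + h) ω = i}) ≤ (|c| + 1) * h := by
    intro i
    obtain ⟨p, hp, hpH⟩ := hδh ⟨hpos, hh⟩ t i i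
    have h1 := hpH Set.univ MeasurableSet.univ
    rw [Set.univ_inter, Set.univ_inter] at h1
    have h2 := measureReal_sdiff_add_inter (μ := P) (s := {ω | B t ω = i})
      (hB (t + h) (measurableSet_singleton i))
    change P.real ({ω | B t ω = i} \ {ω | B (t + h) ω = i}) +
      P.real ({ω | B t ω = i} ∩ {ω | B (t + h) ω = i}) = _ at h2
    rw [h1] at h2
    have h3 : 1 - p ≤ (|c| + 1) * h := by
      rw [Matrix.one_apply_eq] at hp
      have h4 : -(h * Q i i) ≤ h * |c| := by
        rw [← mul_neg]
        exact mul_le_mul_of_nonneg_left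
          ((neg_le_abs _).trans ((hc i).trans (le_abs_self c))) h.2
      linarith [(abs_le.1 hp).1]
    calc _ = (1 - p) * P.real {ω | B t ω = i} := by linarith
      _ ≤ (|c| + 1) * h * P.real {ω | B t ω = i} := by gcongr
      _ ≤ (|c| + 1) * h * 1 := by gcongr; exact measureReal_le_one
      _ = _ := mul_one _
  calc _ ≤ P.real (⋃ i, {ω | B t ω = i} \ {ω | B (t + h) ω = i}) :=
        measureReal_mono fun ω hω => Set.mem_iUnion.2 ⟨B t ω, rfl, hω⟩
    _ ≤ ∑ i, P.real ({ω | B t ω = i} \ {ω | B (t + h) ω = i}) := measureReal_iUnion_fintype_le _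
    _ ≤ ∑ _i : S, (|c| + 1) * h := Finset.sum_le_sum fun i _ => key i
    _ = _ := by simp [mul_assoc]

theorem integrable_of_abs_le {f : Ω → ℝ} (hf : Measurable f) {C : ℝ} (hC : ∀ ω, |f ω| ≤ C) :
    Integrable f P :=
  Integrable.of_bound hf.aestronglyMeasurable C (ae_of_all _ hC)

/-- The generator `Q` governs the conditional drift of functions of the present state with
coefficients that depend on the history. -/
theorem HasLocalRates.abs_integral_drift_le (hQ : HasLocalRates P Q B)
    (hB : ∀ t, Measurable (B t)) (K : ℝ) {ε : ℝ} (hε : 0 < ε) :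
    ∀ᶠ h : ℝ≥0 in 𝓝[>] 0, ∀ (t : ℝ≥0) (f : S → Ω → ℝ), (∀ l, Measurable[history B t] (f l)) →
      (∀ l ω, |f l ω| ≤ K) →
      |∫ ω, (f (B (t + h) ω) ω - f (B t ω) ω - h * ∑ l, Q (B t ω) l * f l ω) ∂P| ≤ ε * h := by
  -- There are `card S * card S` pairs of states, each with an error at most `ε' * h * |K|`; the `+
  -- 1` keeps the denominator positive.
  set ε' : ℝ := ε / (Fintype.card S * Fintype.card S * |K| + 1) with hε'
  have hε'0 : 0 < ε' := by positivity
  filter_upwards [hQ ε' hε'0] with h hh t f hf hK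
  choose p hp hpH using hh t
  have hfm : ∀ l, Measurable (f l) := fun l => (hf l).mono (history_le hB t) le_rfl
  have hst : ∀ u k, MeasurableSet {ω | B u ω = k} := fun u k => hB u (measurableSet_singleton k)
  have hfi : ∀ l, Integrable (f l) P := fun l => integrable_of_abs_le (hfm l) (hK l)
  -- Split by the states `k` at `t` and `l` at `t + h`. As `f l` is known at time `t`, each pair
  -- then contributes the rate error times an integral over `B t = k`.
  have hpt : ∀ ω, f (B (t + h) ω) ω - f (B t ω) ω - h * ∑ l, Q (B t ω) l * f l ω =
      ∑ k, ∑ l, (({ω | B t ω = k} ∩ {ω | B (t + h) ω = l}).indicator (f l) ω -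
        ((1 : Matrix S S ℝ) k l + h * Q k l) * {ω | B t ω = k}.indicator (f l) ω) := by
    intro ω
    have h1 : ∑ k, ∑ l, ({ω | B t ω = k} ∩ {ω | B (t + h) ω = l}).indicator (f l) ω =
        f (B (t + h) ω) ω := by
      rw [Finset.sum_eq_single (B t ω), Finset.sum_eq_single (B (t + h) ω)]
      · simp [Set.indicator]
      · intro l _ hl
        simp [Set.indicator, hl.symm]
      · simp
      · intro k _ hk
        simp [Set.indicator, hk.symm]
      · simp
    have h2 : ∑ k, ∑ l, ((1 : Matrix S S ℝ) k l + h * Q k l) *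
        {ω | B t ω = k}.indicator (f l) ω = f (B t ω) ω + h * ∑ l, Q (B t ω) l * f l ω := by
      rw [Finset.sum_eq_single (B t ω)]
      · simp [Set.indicator, add_mul, Finset.sum_add_distrib, Matrix.one_apply, Finset.mul_sum,
          mul_assoc]
      · intro k _ hk
        simp [Set.indicator, hk.symm]
      · simp
    simp only [Finset.sum_sub_distrib]
    rw [h1, h2]
    ring
  have hint : ∀ k l, ∫ ω, (({ω | B t ω = k} ∩ {ω | B (t + h) ω = l}).indicator (f l) ω -
        ((1 : Matrix S S ℝ) k l + h * Q k l) * {ω | B t ω = k}.indicator (f l) ω) ∂P =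
      (p k l - ((1 : Matrix S S ℝ) k l + h * Q k l)) * ∫ ω in {ω | B t ω = k}, f l ω ∂P := by
    intro k l
    rw [integral_sub ((hfi l).indicator ((hst _ _).inter (hst _ _)))
        (((hfi l).indicator (hst _ _)).const_mul _), integral_const_mul,
      integral_indicator ((hst _ _).inter (hst _ _)), integral_indicator (hst _ _),
      setIntegral_eq_mul_of_measureReal_inter (history_le hB t) (hpH k l) (hf l)]
    ring
  have hbound : ∀ k l, |∫ ω in {ω | B t ω = k}, f l ω ∂P| ≤ |K| := by
    intro k l
    have h1 := norm_setIntegral_le_of_norm_le_const (μ := P) (s := {ω | B t ω = k})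
      (measure_lt_top _ _) (f := f l) (C := |K|) fun ω _ => (hK l ω).trans (le_abs_self K)
    calc _ ≤ |K| * P.real {ω | B t ω = k} := h1
      _ ≤ |K| * 1 := by gcongr; exact measureReal_le_one
      _ = _ := mul_one _
  have hI : ∀ k l, Integrable (fun ω =>
      (({ω | B t ω = k} ∩ {ω | B (t + h) ω = l}).indicator (f l) ω -
        ((1 : Matrix S S ℝ) k l + h * Q k l) * {ω | B t ω = k}.indicator (f l) ω)) P :=
    fun k l => ((hfi l).indicator ((hst _ _).inter (hst _ _))).sub
      (((hfi l).indicator (hst _ _)).const_mul _)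
  simp_rw [hpt]
  rw [integral_finsetSum _ fun k _ => integrable_finsetSum _ fun l _ => hI k l]
  calc _ ≤ ∑ k : S, ∑ l : S, ε' * h * |K| := by
        refine (Finset.abs_sum_le_sum_abs _ _).trans (Finset.sum_le_sum fun k _ => ?_)
        rw [integral_finsetSum _ fun l _ => hI k l]
        refine (Finset.abs_sum_le_sum_abs _ _).trans (Finset.sum_le_sum fun l _ => ?_)
        rw [hint, abs_mul]
        exact mul_le_mul (hp k l) (hbound k l) (abs_nonneg _) (by positivity)
    _ = ε' * (Fintype.card S * Fintype.card S * |K|) * h := by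
        simp only [Finset.sum_const, Finset.card_univ, nsmul_eq_mul]; ring
    _ ≤ ε * h := by
        refine mul_le_mul_of_nonneg_right ?_ h.2
        rw [hε', div_mul_eq_mul_div, div_le_iff₀ (by positivity)]
        nlinarith

end

/-! ### One-step increments of `W (d - D t) (B t)` -/

/-- Bounds on `[-R, R]` for a family of functions `W · i` with derivatives `W' · i`: both are
bounded by `K`, and `K` controls the first-order Taylor remainder. -/
structure TaylorBound {S : Type*} (W W' : ℝ → S → ℝ) (R K : ℝ) : Prop where
  abs_le : ∀ x i, |x| ≤ R → |W x i| ≤ K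
  abs_deriv_le : ∀ x i, |x| ≤ R → |W' x i| ≤ K
  remainder_le : ∀ x y i, |x| ≤ R → |y| ≤ R → |W y i - W x i - (y - x) * W' x i| ≤ K * (y - x) ^ 2

/-- Three errors add up: the Taylor remainder, the replacement of `x - y` by `h * w`, and the
evaluation of `W'` at `i` instead of `j`. The last is only `O(h)`, but occurs only when the state
has changed. -/
theorem TaylorBound.abs_sub_add_le {S : Type*} [DecidableEq S] {W W' : ℝ → S → ℝ} {R K : ℝ}
    (hW : TaylorBound W W' R K) {x y : ℝ} (hx : |x| ≤ R) (hy : |y| ≤ R) {w h V : ℝ} (hh : 0 ≤ h)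
    (hw : |w| ≤ V) (hxy : |x - y| ≤ V * h) (i j : S) :
    |W y j - W x j + h * (w * W' x i)| ≤
      K * V ^ 2 * h ^ 2 + K * |x - y - h * w| + 2 * K * V * h * (if j ≠ i then 1 else 0) := by
  have hK : 0 ≤ K := (abs_nonneg _).trans (hW.abs_le x i hx)
  have hV : 0 ≤ V := (abs_nonneg _).trans hw
  have h1 := hW.remainder_le x y j hx hy
  have h2 : K * (y - x) ^ 2 ≤ K * V ^ 2 * h ^ 2 := by
    have : (y - x) ^ 2 ≤ (V * h) ^ 2 := by
      rw [← neg_sub x y, neg_sq]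
      exact sq_le_sq' (_root_.abs_le.1 hxy).1 (_root_.abs_le.1 hxy).2
    calc _ ≤ K * (V * h) ^ 2 := by gcongr
      _ = _ := by ring
  have h3 : |(x - y - h * w) * W' x j| ≤ K * |x - y - h * w| := by
    rw [abs_mul, mul_comm K]
    exact mul_le_mul_of_nonneg_left (hW.abs_deriv_le x j hx) (abs_nonneg _)
  have h4 : |h * w * (W' x i - W' x j)| ≤ 2 * K * V * h * (if j ≠ i then 1 else 0) := by
    by_cases hij : j = i
    · simp [hij]
    · rw [if_pos hij, abs_mul, abs_mul, abs_of_nonneg hh]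
      calc _ ≤ h * V * (K + K) := by
            gcongr
            exact (abs_sub _ _).trans
              (add_le_add (hW.abs_deriv_le x i hx) (hW.abs_deriv_le x j hx))
        _ = _ := by ring
  have h5 : W y j - W x j + h * (w * W' x i) = (W y j - W x j - (y - x) * W' x j) -
      (x - y - h * w) * W' x j + h * w * (W' x i - W' x j) := by ring
  rw [h5]
  calc _ ≤ |W y j - W x j - (y - x) * W' x j| + |(x - y - h * w) * W' x j| +
        |h * w * (W' x i - W' x j)| :=
        (abs_add_le _ _).trans (add_le_add_left (abs_sub _ _) _)
    _ ≤ _ := add_le_add (add_le_add (h1.trans h2) h3) h4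

theorem right_continuous_comp {Ω S : Type*} [TopologicalSpace S] [DiscreteTopology S]
    {B : ℝ≥0 → Ω → S} (v : S → ℝ)
    (hc : ∀ ω t, ContinuousWithinAt (fun u => B u ω) (Set.Ici t) t) (ω : Ω) (t : ℝ≥0) :
    ContinuousWithinAt (fun u => v (B u ω)) (Set.Ici t) t :=
  (continuous_of_discreteTopology (f := v)).continuousAt.comp_continuousWithinAt (hc ω t)

section

variable {Ω S : Type*} [MeasurableSpace Ω] {P : Measure Ω} [IsProbabilityMeasure P] [Fintype S]
  [DecidableEq S] [MeasurableSpace S] [DiscreteMeasurableSpace S] [TopologicalSpace S]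
  [DiscreteTopology S] {Q : Matrix S S ℝ} {B : ℝ≥0 → Ω → S} {v : S → ℝ} {V : ℝ}

/-- The speed at a later time differs from `v (B t)` only if the state does, which has probability
`O(h)`; integrating over a time span `h` gives `O(h ^ 2)`. -/
theorem HasLocalRates.integral_abs_traveledDistance_sub_le (hQ : HasLocalRates P Q B)
    (hB : ∀ t, Measurable (B t))
    (hc : ∀ ω t, ContinuousWithinAt (fun u => B u ω) (Set.Ici t) t) (hV : ∀ i, |v i| ≤ V)
    (hV0 : 0 ≤ V) :
    ∃ C : ℝ, 0 ≤ C ∧ ∀ᶠ h : ℝ≥0 in 𝓝[>] 0, ∀ t : ℝ≥0,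
      P.real {ω | B (t + h) ω ≠ B t ω} ≤ C * h ∧
      ∫ ω, |traveledDistance (fun u => v (B u ω)) (t + h) -
        traveledDistance (fun u => v (B u ω)) t - h * v (B t ω)| ∂P ≤ C * h ^ 2 := by
  obtain ⟨C, hC0, δ, hδ, hC⟩ := hQ.measureReal_ne_le hB
  refine ⟨C * (2 * V + 1), by positivity, ?_⟩
  filter_upwards [Ioo_mem_nhdsGT hδ] with h hh t
  refine ⟨(hC t h hh.2).trans ?_, ?_⟩
  · refine mul_le_mul_of_nonneg_right ?_ h.2
    nlinarith [mul_nonneg hC0 hV0]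
  have hvm : Measurable v := Measurable.of_discrete
  have h1 : ∀ u, t ≤ u → u ≤ t + h → ∫ ω, |v (B u ω) - v (B t ω)| ∂P ≤ 2 * V * (C * h) := by
    intro u htu huh
    obtain ⟨r, rfl⟩ := exists_add_of_le htu
    have hr : r ≤ h := by simpa using huh
    have hm : MeasurableSet {ω | B (t + r) ω ≠ B t ω} :=
      (measurableSet_eq_fun (hB _) (hB _)).compl
    calc _ ≤ ∫ ω, {ω | B (t + r) ω ≠ B t ω}.indicator (fun _ => 2 * V) ω ∂P := by
          refine integral_mono_of_nonneg (ae_of_all _ fun _ => abs_nonneg _)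
            ((integrable_const _).indicator hm) (ae_of_all _ fun ω => ?_)
          by_cases h : B (t + r) ω = B t ω
          · simp [h]
          · simp only [Set.indicator, Set.mem_ofPred_eq, ne_eq, h, not_false_eq_true, if_true]
            linarith [abs_sub (v (B (t + r) ω)) (v (B t ω)), hV (B (t + r) ω), hV (B t ω)]
      _ = 2 * V * P.real {ω | B (t + r) ω ≠ B t ω} := by
          rw [integral_indicator_const _ hm, smul_eq_mul, mul_comm]
      _ ≤ 2 * V * (C * h) := by
          gcongr
          refine (hC t r (hr.trans_lt hh.2)).trans ?_
          gcongr
  calc _ ≤ h * (2 * V * (C * h)) := _root_.integral_abs_traveledDistance_sub_le (C := V)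
        (G := fun u ω => v (B u ω)) (fun u => hvm.comp (hB u)) (right_continuous_comp v hc)
        (fun _ _ => hV _) h1
    _ = C * (2 * V) * h ^ 2 := by ring
    _ ≤ _ := by gcongr; linarith

/-- If `v i * W' x i = ∑ j, Q i j * W x j`, then `W (d - D t) (B t)` has, on events of the history
up to time `t`, increments of mean `o(h)`; here `D` is the distance traveled at the speed
`v (B t)`. -/
theorem HasLocalRates.abs_setIntegral_increment_le (hQ : HasLocalRates P Q B)
    (hB : ∀ t, Measurable (B t))
    (hc : ∀ ω t, ContinuousWithinAt (fun u => B u ω) (Set.Ici t) t) (hV : ∀ i, |v i| ≤ V)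
    {W W' : ℝ → S → ℝ} {R K d : ℝ} (hW : TaylorBound W W' R K)
    (hWc : ∀ i, Continuous fun x => W x i)
    (hgen : ∀ x i, v i * W' x i = ∑ j, Q i j * W x j) {ε : ℝ} (hε : 0 < ε) :
    ∀ᶠ h : ℝ≥0 in 𝓝[>] 0, ∀ (t : ℝ≥0) (A : Set Ω), MeasurableSet[history B t] A →
      (∀ ω ∈ A, |d - traveledDistance (fun u => v (B u ω)) t| ≤ R) →
      (∀ ω ∈ A, |d - traveledDistance (fun u => v (B u ω)) (t + h)| ≤ R) →
      |∫ ω in A, (W (d - traveledDistance (fun u => v (B u ω)) (t + h)) (B (t + h) ω) -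
        W (d - traveledDistance (fun u => v (B u ω)) t) (B t ω)) ∂P| ≤ ε * h := by
  have hΩ : Nonempty Ω := nonempty_of_isProbabilityMeasure P
  obtain ⟨ω₀⟩ := hΩ
  have hV0 : 0 ≤ V := (abs_nonneg _).trans (hV (B 0 ω₀))
  have hvm : Measurable v := Measurable.of_discrete
  set D : ℝ≥0 → Ω → ℝ := fun t ω => traveledDistance (fun u => v (B u ω)) t with hD
  have hDh : ∀ t, Measurable[history B t] (D t) := fun t =>
    measurable_traveledDistance (G := fun u ω => v (B u ω))
      (fun u hu => hvm.comp (measurable_history B hu)) (right_continuous_comp v hc)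
  have hDm : ∀ t, Measurable (D t) := fun t => (hDh t).mono (history_le hB t) le_rfl
  have hWm : Measurable fun x : ℝ × S => W x.1 x.2 :=
    measurable_from_prod_countable_left fun i => (hWc i).measurable
  by_cases hR : 0 ≤ R
  swap
  · refine Eventually.of_forall fun h t A hA h1 h2 => ?_
    have : A = ∅ := Set.eq_empty_of_forall_notMem fun ω hω =>
      hR ((abs_nonneg _).trans (h1 ω hω))
    simp [this]; positivity
  have hK : 0 ≤ K := (abs_nonneg _).trans (hW.abs_le 0 (B 0 ω₀) (by simpa using hR))
  obtain ⟨C, hC0, hC⟩ := hQ.integral_abs_traveledDistance_sub_le hB hc hV hV0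
  have hsmall : ∀ᶠ h : ℝ≥0 in 𝓝[>] 0,
      (K * V ^ 2 + K * C + 2 * K * V * C) * (h : ℝ) < ε / 2 := by
    have : Continuous fun h : ℝ≥0 => (K * V ^ 2 + K * C + 2 * K * V * C) * (h : ℝ) := by fun_prop
    refine nhdsWithin_le_nhds (this.tendsto 0 (gt_mem_nhds ?_))
    simpa using hε
  filter_upwards [hC, hsmall, hQ.abs_integral_drift_le hB K (half_pos hε)] with h hC hsmall hdrift
    t A hA hA1 hA2
  have hAm : MeasurableSet A := history_le hB t A hA
  -- The distance is frozen at time `t`, and `A` is absorbed into the coefficients, which stay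
  -- measurable for the history.
  set f : S → Ω → ℝ := fun l => A.indicator fun ω => W (d - D t ω) l with hf
  have hfh : ∀ l, Measurable[history B t] (f l) := fun l =>
    Measurable.indicator ((hWc l).measurable.comp (measurable_const.sub (hDh t))) hA
  have hfK : ∀ l ω, |f l ω| ≤ K := by
    intro l ω
    by_cases hω : ω ∈ A
    · simpa [hf, hω] using hW.abs_le _ l (hA1 ω hω)
    · simpa [hf, hω] using hK
  have hmain := hdrift t f hfh hfK
  -- `main` is the increment due to the change of state alone, less its drift. By `hgen` the drift
  -- equals `h * v * W'`, so `full - main` is the change due to the distance plus its compensating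
  -- first-order term.
  set main : Ω → ℝ := fun ω => W (d - D t ω) (B (t + h) ω) - W (d - D t ω) (B t ω) -
    h * ∑ l, Q (B t ω) l * W (d - D t ω) l with hmaindef
  have hmain_eq : ∫ ω, (f (B (t + h) ω) ω - f (B t ω) ω - h * ∑ l, Q (B t ω) l * f l ω) ∂P =
      ∫ ω in A, main ω ∂P := by
    rw [← integral_indicator hAm]
    refine integral_congr_ae (ae_of_all _ fun ω => ?_)
    by_cases hω : ω ∈ A <;> simp [hf, hω, hmaindef]
  rw [hmain_eq] at hmain
  have hWXm : ∀ u r, Measurable fun ω => W (d - D u ω) (B r ω) := fun u r =>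
    hWm.comp ((measurable_const.sub (hDm u)).prodMk (hB r))
  have hmainm : Measurable main := by
    refine ((hWXm _ _).sub (hWXm _ _)).sub (measurable_const.mul ?_)
    refine Finset.measurable_sum _ fun l _ => Measurable.mul ?_ ?_
    · exact (Measurable.of_discrete (f := fun i => Q i l)).comp (hB t)
    · exact (hWc l).measurable.comp (measurable_const.sub (hDm t))
  set full : Ω → ℝ := fun ω => W (d - D (t + h) ω) (B (t + h) ω) - W (d - D t ω) (B t ω)
    with hfulldef
  have hfullm : Measurable full := (hWXm _ _).sub (hWXm _ _)
  have hfull : IntegrableOn full A P := by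
    refine Measure.integrableOn_of_bounded (M := K + K) (measure_ne_top _ _)
      hfullm.aestronglyMeasurable (ae_restrict_of_forall_mem hAm fun ω hω => ?_)
    exact (abs_sub _ _).trans
      (add_le_add (hW.abs_le _ _ (hA2 ω hω)) (hW.abs_le _ _ (hA1 ω hω)))
  set bd : Ω → ℝ := fun ω => K * V ^ 2 * h ^ 2 + K * |D (t + h) ω - D t ω - h * v (B t ω)| +
    2 * K * V * h * {ω | B (t + h) ω ≠ B t ω}.indicator 1 ω with hbd
  have hDV : ∀ ω, |D (t + h) ω - D t ω| ≤ V * h := by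
    intro ω
    have := abs_traveledDistance_sub_le (right_continuous_comp v hc ω) (fun u => hV (B u ω)) t
      (t + h)
    simpa using this
  have hrem : ∀ ω ∈ A, |full ω - main ω| ≤ bd ω := by
    intro ω hω
    have h1 : |W (d - D (t + h) ω) (B (t + h) ω) - W (d - D t ω) (B (t + h) ω) +
        h * (v (B t ω) * W' (d - D t ω) (B t ω))| ≤ K * V ^ 2 * h ^ 2 +
          K * |d - D t ω - (d - D (t + h) ω) - h * v (B t ω)| +
          2 * K * V * h * (if B (t + h) ω ≠ B t ω then 1 else 0) :=
      hW.abs_sub_add_le (hA1 ω hω) (hA2 ω hω) h.2 (hV (B t ω)) (by simpa using hDV ω) _ _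
    have h2 : full ω - main ω = W (d - D (t + h) ω) (B (t + h) ω) - W (d - D t ω) (B (t + h) ω) +
        h * (v (B t ω) * W' (d - D t ω) (B t ω)) := by
      simp only [hfulldef, hmaindef, hgen]; ring
    have h3 : d - D t ω - (d - D (t + h) ω) - h * v (B t ω) =
        D (t + h) ω - D t ω - h * v (B t ω) := by ring
    rw [h3] at h1
    have h4 : {ω | B (t + h) ω ≠ B t ω}.indicator (1 : Ω → ℝ) ω =
        if B (t + h) ω ≠ B t ω then 1 else 0 := by
      simp [Set.indicator]
    simp only [hbd]
    rw [h2, h4]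
    exact h1
  have hjm : MeasurableSet {ω | B (t + h) ω ≠ B t ω} :=
    (measurableSet_eq_fun (hB _) (hB _)).compl
  have hi1 : Integrable (fun ω => |D (t + h) ω - D t ω - h * v (B t ω)|) P := by
    refine integrable_of_abs_le ((((hDm _).sub (hDm _)).sub
      (measurable_const.mul (hvm.comp (hB t)))).abs) (C := V * h + h * V) fun ω => ?_
    rw [abs_abs]
    refine (abs_sub _ _).trans (add_le_add (hDV ω) ?_)
    rw [abs_mul, abs_of_nonneg (NNReal.coe_nonneg h)]
    exact mul_le_mul_of_nonneg_left (hV _) h.2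
  have hi2 : Integrable ({ω | B (t + h) ω ≠ B t ω}.indicator (1 : Ω → ℝ)) P :=
    (integrable_const (1 : ℝ)).indicator hjm
  have hi12 : Integrable (fun ω => K * V ^ 2 * (h : ℝ) ^ 2 +
      K * |D (t + h) ω - D t ω - h * v (B t ω)|) P := (integrable_const _).add (hi1.const_mul K)
  have hbdi : Integrable bd P := hi12.add (hi2.const_mul _)
  have hbdnn : ∀ ω, 0 ≤ bd ω := fun ω => by
    have : 0 ≤ {ω | B (t + h) ω ≠ B t ω}.indicator (1 : Ω → ℝ) ω :=
      Set.indicator_nonneg (fun _ _ => zero_le_one) _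
    positivity
  have hbdint : ∫ ω, bd ω ∂P ≤ (K * V ^ 2 + K * C + 2 * K * V * C) * h * h := by
    simp only [hbd]
    rw [integral_add hi12 (hi2.const_mul _), integral_add (integrable_const _) (hi1.const_mul K),
      integral_const_mul K, integral_const_mul (2 * K * V * (h : ℝ)), integral_indicator_one hjm, integral_const,
      probReal_univ, one_smul]
    calc _ ≤ K * V ^ 2 * (h : ℝ) ^ 2 + K * (C * (h : ℝ) ^ 2) + 2 * K * V * h * (C * h) := by
          gcongr
          · exact (hC t).2
          · exact (hC t).1
      _ = _ := by ring
  have hremm : IntegrableOn (fun ω => full ω - main ω) A P :=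
    Integrable.mono' hbdi.integrableOn (hfullm.sub hmainm).aestronglyMeasurable
      (ae_restrict_of_forall_mem hAm hrem)
  have hmaini : IntegrableOn main A P := by
    simpa [Pi.sub_def] using hfull.sub hremm
  have hsplit : ∫ ω in A, full ω ∂P = ∫ ω in A, main ω ∂P + ∫ ω in A, (full ω - main ω) ∂P := by
    rw [integral_sub hfull hmaini]; ring
  have hremi : |∫ ω in A, (full ω - main ω) ∂P| ≤ ε / 2 * h := by
    calc _ ≤ ∫ ω in A, |full ω - main ω| ∂P := abs_integral_le_integral_abs
      _ ≤ ∫ ω in A, bd ω ∂P := setIntegral_mono_on hremm.abs hbdi.integrableOn hAm hrem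
      _ ≤ ∫ ω, bd ω ∂P := setIntegral_le_integral hbdi (ae_of_all _ hbdnn)
      _ ≤ _ := hbdint
      _ ≤ _ := mul_le_mul_of_nonneg_right hsmall.le h.2
  rw [hsplit]
  calc _ ≤ _ := abs_add_le _ _
    _ ≤ ε / 2 * h + ε / 2 * h := add_le_add hmain hremi
    _ = ε * h := by ring

end

/-! ### Taylor bounds and the matrix exponential -/

/-- Compactness of `[-R, R]` bounds all three functions, and the mean value inequality, applied to
`W'` and then to `z ↦ W z i - z * W' x i`, gives the remainder. -/
theorem exists_taylorBound {S : Type*} [Finite S] {W W' W'' : ℝ → S → ℝ}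
    (hW : ∀ x i, HasDerivAt (fun x => W x i) (W' x i) x)
    (hW' : ∀ x i, HasDerivAt (fun x => W' x i) (W'' x i) x)
    (hW'' : ∀ i, Continuous fun x => W'' x i) (R : ℝ) : ∃ K, TaylorBound W W' R K := by
  have bound : ∀ F : ℝ → S → ℝ, (∀ i, Continuous fun x => F x i) →
      ∃ K, ∀ x i, |x| ≤ R → |F x i| ≤ K := by
    intro F hF
    choose K hK using fun i => (isCompact_Icc (a := -R) (b := R)).exists_bound_of_continuousOn
      (hF i).continuousOn
    obtain ⟨K', hK'⟩ := (Set.finite_range K).bddAbove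
    exact ⟨K', fun x i hx => (hK i x (abs_le.1 hx)).trans (hK' ⟨i, rfl⟩)⟩
  obtain ⟨K₀, h0⟩ := bound W fun i => continuous_iff_continuousAt.2 fun x => (hW x i).continuousAt
  obtain ⟨K₁, h1⟩ := bound W' fun i => continuous_iff_continuousAt.2 fun x => (hW' x i).continuousAt
  obtain ⟨K₂, h2⟩ := bound W'' hW''
  refine ⟨max K₀ (max K₁ K₂), fun x i hx => (h0 x i hx).trans (le_max_left _ _),
    fun x i hx => (h1 x i hx).trans ((le_max_left _ _).trans (le_max_right _ _)),
    fun x y i hx hy => ?_⟩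
  have hseg : ∀ z ∈ Set.uIcc x y, |z| ≤ R := fun z hz =>
    abs_le.2 (Set.uIcc_subset_Icc (abs_le.1 hx) (abs_le.1 hy) hz)
  have hd : ∀ z ∈ Set.uIcc x y, |W' z i - W' x i| ≤ K₂ * |y - x| := by
    intro z hz
    have h3 := (convex_uIcc x y).norm_image_sub_le_of_norm_hasDerivWithin_le
      (fun w _ => (hW' w i).hasDerivWithinAt) (fun w hw => h2 w i (hseg w hw))
      Set.left_mem_uIcc hz
    refine h3.trans (mul_le_mul_of_nonneg_left ?_ ((abs_nonneg _).trans (h2 x i hx)))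
    exact Set.abs_sub_left_of_mem_uIcc hz
  have h4 := (convex_uIcc x y).norm_image_sub_le_of_norm_hasDerivWithin_le
    (f := fun z => W z i - z * W' x i) (f' := fun z => W' z i - W' x i)
    (fun z _ => ((hW z i).sub (by simpa using (hasDerivAt_id z).mul_const (W' x i))).hasDerivWithinAt)
    hd Set.left_mem_uIcc Set.right_mem_uIcc
  simp only [Real.norm_eq_abs] at h4
  calc |W y i - W x i - (y - x) * W' x i| = |W y i - y * W' x i - (W x i - x * W' x i)| := by
        congr 1; ring
    _ ≤ K₂ * |y - x| * |y - x| := h4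
    _ = K₂ * (y - x) ^ 2 := by rw [mul_assoc, ← sq, sq_abs]
    _ ≤ _ := mul_le_mul_of_nonneg_right ((le_max_right _ _).trans (le_max_right _ _)) (sq_nonneg _)

theorem Matrix.hasDerivAt_mul_exp_smul_apply {S : Type*} [Fintype S] [DecidableEq S]
    (A L : Matrix S S ℝ) (i j : S) (x : ℝ) :
    HasDerivAt (fun x : ℝ => (A * NormedSpace.exp (x • L)) i j)
      ((A * L * NormedSpace.exp (x • L)) i j) x := by
  let _ : NormedRing (Matrix S S ℝ) := Matrix.linftyOpNormedRing
  let _ : NormedAlgebra ℝ (Matrix S S ℝ) := Matrix.linftyOpNormedAlgebra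
  have h1 : HasDerivAt (fun x : ℝ => A * NormedSpace.exp (x • L))
      (A * (L * NormedSpace.exp (x • L))) x := (hasDerivAt_exp_smul_const' (𝕂 := ℝ) L x).const_mul A
  rw [Matrix.mul_assoc]
  exact (LinearMap.toContinuousLinearMap (Matrix.entryLinearMap ℝ ℝ i j)).hasFDerivAt.comp_hasDerivAt
    x h1

/-! ### Optional stopping along time grids -/

/-- Telescoping: the increment from `k` to `k + 1` counts exactly on the event `k < κ`. -/
theorem setIntegral_stopped_sub {Ω : Type*} [MeasurableSpace Ω] {P : Measure Ω}
    {a : ℕ → Ω → ℝ} {m : ℕ} (ha : ∀ k ≤ m, Integrable (a k) P) {κ : Ω → ℕ}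
    (hκ : ∀ k, MeasurableSet {ω | k < κ ω}) (hm : ∀ ω, κ ω ≤ m) (A : Set Ω) :
    ∫ ω in A, (a (κ ω) ω - a 0 ω) ∂P =
      ∑ k ∈ Finset.range m, ∫ ω in A ∩ {ω | k < κ ω}, (a (k + 1) ω - a k ω) ∂P := by
  have hpt : ∀ ω, a (κ ω) ω - a 0 ω =
      ∑ k ∈ Finset.range m, {ω | k < κ ω}.indicator (fun ω => a (k + 1) ω - a k ω) ω := by
    intro ω
    rw [← Finset.sum_range_sub (fun k => a k ω) (κ ω)]
    simp only [Set.indicator, Set.mem_ofPred_eq]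
    rw [← Finset.sum_filter]
    refine Finset.sum_congr ?_ fun _ _ => rfl
    ext k
    have := hm ω
    simp only [Finset.mem_range, Finset.mem_filter]
    omega
  simp_rw [hpt]
  rw [integral_finsetSum]
  · exact Finset.sum_congr rfl fun k _ => setIntegral_indicator (hκ k)
  · intro k hk
    have hk := Finset.mem_range.1 hk
    exact (((ha (k + 1) hk).sub (ha k hk.le)).indicator (hκ k)).integrableOn

theorem measurable_apply_nat {Ω E : Type*} [MeasurableSpace Ω] [MeasurableSpace E]
    {a : ℕ → Ω → E} (ha : ∀ k, Measurable (a k)) {κ : Ω → ℕ}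
    (hκ : ∀ k, MeasurableSet {ω | k < κ ω}) : Measurable fun ω => a (κ ω) ω := by
  have h1 : Measurable fun x : ℕ × Ω => a x.1 x.2 := measurable_from_prod_countable_right ha
  exact h1.comp ((measurable_of_Ioi hκ).prodMk measurable_id)

theorem tendsto_ceil_mul_div (u : ℝ≥0) :
    Tendsto (fun n : ℕ => (⌈u * (n + 1)⌉₊ : ℝ≥0) * (1 / (n + 1))) atTop (𝓝[≥] u) := by
  have hlow : ∀ n : ℕ, u ≤ (⌈u * (n + 1)⌉₊ : ℝ≥0) * (1 / (n + 1)) := fun n => by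
    rw [mul_one_div, le_div_iff₀ (by positivity)]
    exact Nat.le_ceil _
  refine tendsto_nhdsWithin_iff.2 ⟨?_, Eventually.of_forall hlow⟩
  have hup : ∀ n : ℕ, (⌈u * (n + 1)⌉₊ : ℝ≥0) * (1 / (n + 1)) ≤ u + 1 / ((n : ℝ≥0) + 1) := fun n => by
    rw [mul_one_div, div_le_iff₀ (by positivity), add_mul, one_div,
      inv_mul_cancel₀ (by positivity)]
    exact (Nat.ceil_lt_add_one zero_le).le
  refine tendsto_of_tendsto_of_tendsto_of_le_of_le tendsto_const_nhds ?_ hlow hup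
  simpa using (tendsto_one_div_add_atTop_nhds_zero_nat (𝕜 := ℝ≥0)).const_add u

/-- A sequence of grids in time, of mesh sizes `h n` that tend to zero, whose `k n u`-th grid point
is the first one not before `u`. -/
theorem exists_grid : ∃ (h : ℕ → ℝ≥0) (k : ℕ → ℝ≥0 → ℕ), (∀ n, 0 < h n) ∧
    Tendsto h atTop (𝓝 0) ∧ (∀ n i u, i < k n u ↔ i * h n < u) ∧
    (∀ n T : ℕ, ((T * (n + 1) : ℕ) : ℝ≥0) * h n = T) ∧
    ∀ u, Tendsto (fun n => (k n u : ℝ≥0) * h n) atTop (𝓝[≥] u) := by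
  refine ⟨fun n => 1 / (n + 1), fun n u => ⌈u * (n + 1)⌉₊, fun n => by positivity,
    tendsto_one_div_add_atTop_nhds_zero_nat, fun n i u => ?_, fun n T => ?_, tendsto_ceil_mul_div⟩
  · rw [Nat.lt_ceil, mul_one_div, div_lt_iff₀ (by positivity)]
  · push_cast
    field_simp

section

variable {Ω S : Type*} [MeasurableSpace Ω] {P : Measure Ω} [IsProbabilityMeasure P] [Fintype S]
  [DecidableEq S] [MeasurableSpace S] [DiscreteMeasurableSpace S] [TopologicalSpace S]
  [DiscreteTopology S] {Q : Matrix S S ℝ} {B : ℝ≥0 → Ω → S} {v : S → ℝ} {c V d : ℝ}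

theorem HasLocalRates.setIntegral_stopped_eq (hQ : HasLocalRates P Q B)
    (hB : ∀ t, Measurable (B t))
    (hc : ∀ ω t, ContinuousWithinAt (fun u => B u ω) (Set.Ici t) t) (hV : ∀ i, |v i| ≤ V)
    (hc0 : 0 < c) (hcv : ∀ i, c ≤ v i) (hd : 0 ≤ d) {W W' W'' : ℝ → S → ℝ}
    (hW : ∀ x i, HasDerivAt (fun x => W x i) (W' x i) x)
    (hW' : ∀ x i, HasDerivAt (fun x => W' x i) (W'' x i) x)
    (hW'' : ∀ i, Continuous fun x => W'' x i)
    (hgen : ∀ x i, v i * W' x i = ∑ j, Q i j * W x j) {τ : Ω → ℝ≥0}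
    (hτ : ∀ ω, IsLeast {t | d ≤ traveledDistance (fun u => v (B u ω)) t} (τ ω))
    {A : Set Ω} (hA : MeasurableSet[history B 0] A) :
    Measurable (fun ω => W 0 (B (τ ω) ω)) ∧
      ∫ ω in A, W 0 (B (τ ω) ω) ∂P = ∫ ω in A, W d (B 0 ω) ∂P := by
  obtain ⟨ω₀⟩ := nonempty_of_isProbabilityMeasure P
  have hV0 : 0 ≤ V := (abs_nonneg _).trans (hV (B 0 ω₀))
  have hv0 : ∀ i, 0 ≤ v i := fun i => hc0.le.trans (hcv i)
  have hvm : Measurable v := Measurable.of_discrete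
  set D : ℝ≥0 → Ω → ℝ := fun t ω => traveledDistance (fun u => v (B u ω)) t with hD
  have hDh : ∀ t, Measurable[history B t] (D t) := fun t =>
    measurable_traveledDistance (G := fun u ω => v (B u ω))
      (fun u hu => hvm.comp (measurable_history B hu)) (right_continuous_comp v hc)
  have hDm : ∀ t, Measurable (D t) := fun t => (hDh t).mono (history_le hB t) le_rfl
  have hWc : ∀ i, Continuous fun x => W x i := fun i =>
    continuous_iff_continuousAt.2 fun x => (hW x i).continuousAt
  have hAm : MeasurableSet A := history_le hB 0 A hA
  -- A deterministic bound for `τ`, chosen integral so that it is a point of every grid.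
  obtain ⟨T, hT⟩ := exists_nat_ge (d / c)
  have hτT : ∀ ω, τ ω ≤ T := fun ω => (hτ ω).2 (le_traveledDistance_of_div_le
    (right_continuous_comp v hc ω) (fun u => hV (B u ω)) hc0 (fun u => hcv _) (by simpa using hT))
  have hlt : ∀ ω t, D t ω < d ↔ t < τ ω := fun ω t =>
    traveledDistance_lt_iff (right_continuous_comp v hc ω) (fun u => hV (B u ω)) (fun u => hv0 _)
      (hτ ω) t
  have hD0 : ∀ ω, D 0 ω = 0 := fun ω => traveledDistance_zero _
  obtain ⟨K, hK⟩ := exists_taylorBound hW hW' hW'' (d + V * T)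
  have hDR : ∀ (t : ℝ≥0) ω, t ≤ T → |d - D t ω| ≤ d + V * T := by
    intro t ω ht
    have h1 := abs_traveledDistance_sub_le (right_continuous_comp v hc ω) (fun u => hV (B u ω)) 0 t
    rw [traveledDistance_zero, NNReal.coe_zero, sub_zero, sub_zero,
      abs_of_nonneg (NNReal.coe_nonneg t)] at h1
    have h2 : (t : ℝ) ≤ T := by exact_mod_cast ht
    calc _ ≤ |d| + |D t ω| := abs_sub _ _
      _ ≤ d + V * t := add_le_add (abs_of_nonneg hd).le h1
      _ ≤ _ := by gcongr
  set M : ℝ≥0 → Ω → ℝ := fun t ω => W (d - D t ω) (B t ω) with hM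
  have hMm : ∀ t, Measurable (M t) := by
    intro t
    have hWm : Measurable fun x : ℝ × S => W x.1 x.2 :=
      measurable_from_prod_countable_left fun i => (hWc i).measurable
    exact hWm.comp ((measurable_const.sub (hDm t)).prodMk (hB t))
  have hMK : ∀ (t : ℝ≥0) ω, t ≤ T → |M t ω| ≤ K := fun t ω ht => hK.abs_le _ _ (hDR t ω ht)
  obtain ⟨h, κ', hh0, hh, hκ', hmh', hκlim⟩ := exists_grid
  set κ : ℕ → Ω → ℕ := fun n ω => κ' n (τ ω) with hκ
  have hκlt : ∀ n k ω, k < κ n ω ↔ k * h n < τ ω := fun n k ω => hκ' n k (τ ω)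
  have hmh : ∀ n : ℕ, ((T * (n + 1) : ℕ) : ℝ≥0) * h n = T := fun n => hmh' n T
  have hκm : ∀ n ω, κ n ω ≤ T * (n + 1) := by
    intro n ω
    by_contra! h1
    rw [hκlt, hmh] at h1
    exact absurd (hτT ω) (not_le.2 h1)
  -- Grid point `k` lies before `τ` exactly when less than `d` has been traveled there, so this
  -- event belongs to the history up to `k * h n`.
  have hκset : ∀ n k, {ω | k < κ n ω} = {ω | D (k * h n) ω < d} := by
    intro n k
    ext ω
    simp only [Set.mem_ofPred_eq]
    rw [hκlt, hlt]
  have hκmeas : ∀ n k, MeasurableSet {ω | k < κ n ω} := fun n k => by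
    rw [hκset]; exact measurableSet_lt (hDm _) measurable_const
  have hgrid : ∀ n k, k ≤ T * (n + 1) → (k : ℝ≥0) * h n ≤ T := by
    intro n k hk
    rw [← hmh n]
    gcongr
  set N : ℕ → Ω → ℝ := fun n ω => M (κ n ω * h n) ω with hN
  have hNm : ∀ n, Measurable (N n) := fun n =>
    measurable_apply_nat (a := fun k => M (k * h n)) (fun k => hMm _) (hκmeas n)
  have hNK : ∀ n ω, |N n ω| ≤ K := fun n ω =>
    hMK (κ n ω * h n) ω (hgrid n (κ n ω) (hκm n ω))
  have hlim : ∀ ω, Tendsto (fun n => N n ω) atTop (𝓝 (W 0 (B (τ ω) ω))) := by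
    intro ω
    have h1 : Tendsto (fun n => (κ n ω : ℝ≥0) * h n) atTop (𝓝[≥] τ ω) := hκlim (τ ω)
    -- The grid points approach `τ` from the right and the state space is discrete, so the state is
    -- eventually equal to its value at `τ`.
    have h2 : ∀ᶠ n in atTop, B (κ n ω * h n) ω = B (τ ω) ω := by
      have := (hc ω (τ ω)).tendsto.comp h1
      rw [nhds_discrete, tendsto_pure] at this
      exact this
    have h3 : Tendsto (fun n => D (κ n ω * h n) ω) atTop (𝓝 d) := by
      have h4 : D (τ ω) ω = d := traveledDistance_eq (right_continuous_comp v hc ω)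
        (fun u => hV (B u ω)) (fun u => hv0 _) hd (hτ ω)
      rw [← h4]
      exact ((continuous_traveledDistance (right_continuous_comp v hc ω)
        (fun u => hV (B u ω))).tendsto (τ ω)).comp (h1.mono_right nhdsWithin_le_nhds)
    have h5 : Tendsto (fun n => W (d - D (κ n ω * h n) ω) (B (τ ω) ω)) atTop
        (𝓝 (W 0 (B (τ ω) ω))) := by
      have := ((hWc (B (τ ω) ω)).tendsto (d - d)).comp (h3.const_sub d)
      rwa [sub_self] at this
    refine h5.congr' ?_
    filter_upwards [h2] with n hn
    simp only [hN, hM]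
    rw [hn]
  refine ⟨measurable_of_tendsto_metrizable hNm (tendsto_pi_nhds.2 hlim), ?_⟩
  have hlimI : Tendsto (fun n => ∫ ω in A, N n ω ∂P) atTop (𝓝 (∫ ω in A, W 0 (B (τ ω) ω) ∂P)) :=
    tendsto_integral_of_dominated_convergence (fun _ => K)
      (fun n => (hNm n).aestronglyMeasurable) (integrable_const K)
      (fun n => ae_of_all _ (hNK n)) (ae_of_all _ hlim)
  have hM0 : ∫ ω in A, W d (B 0 ω) ∂P = ∫ ω in A, M 0 ω ∂P := by
    simp only [hM, hD0, sub_zero]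
  have htend : Tendsto h atTop (𝓝[>] 0) :=
    tendsto_nhdsWithin_iff.2 ⟨hh, Eventually.of_forall hh0⟩
  have hMi : ∀ n, ∀ k ≤ T * (n + 1), Integrable (M (k * h n)) P := fun n k hk =>
    integrable_of_abs_le (hMm _) fun ω => hMK _ ω (hgrid n k hk)
  refine tendsto_nhds_unique hlimI ?_
  rw [hM0, Metric.tendsto_nhds]
  intro ε hε
  -- There are `T * (n + 1)` steps of length `h n`, of total length `T`, so the errors sum to `ε /
  -- (T + 1) * T < ε`.
  have hε' : 0 < ε / (T + 1) := by positivity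
  filter_upwards [htend.eventually (hQ.abs_setIntegral_increment_le hB hc hV hK hWc hgen (d := d)
    hε')] with n hn
  have hstep : ∀ k < T * (n + 1),
      |∫ ω in A ∩ {ω | k < κ n ω}, (M ((k + 1 : ℕ) * h n) ω - M (k * h n) ω) ∂P| ≤
        ε / (T + 1) * h n := by
    intro k hk
    have h1 : ((k + 1 : ℕ) : ℝ≥0) * h n = k * h n + h n := by push_cast; ring
    have h2 := hgrid n (k + 1) hk
    rw [h1] at h2 ⊢
    refine hn (k * h n) _ ?_ (fun ω _ => hDR _ ω (hgrid n k hk.le)) (fun ω _ => hDR _ ω h2)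
    rw [hκset]
    exact MeasurableSet.inter (history_mono B zero_le A hA)
      (measurableSet_lt (hDh _) measurable_const)
  have hNi : Integrable (N n) P := integrable_of_abs_le (hNm n) (hNK n)
  have hM0i : Integrable (M 0) P := integrable_of_abs_le (hMm 0) fun ω => hMK 0 ω zero_le
  have htele := setIntegral_stopped_sub (a := fun k => M (k * h n)) (hMi n) (hκmeas n) (hκm n) A
  rw [Real.dist_eq, ← integral_sub hNi.integrableOn hM0i.integrableOn]
  have htele' : ∫ ω in A, (N n ω - M 0 ω) ∂P = ∑ k ∈ Finset.range (T * (n + 1)),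
      ∫ ω in A ∩ {ω | k < κ n ω}, (M ((k + 1 : ℕ) * h n) ω - M (k * h n) ω) ∂P := by
    simpa [hN] using htele
  rw [htele']
  calc _ ≤ ∑ k ∈ Finset.range (T * (n + 1)), ε / (T + 1) * (h n : ℝ) :=
        (Finset.abs_sum_le_sum_abs _ _).trans
          (Finset.sum_le_sum fun k hk => hstep k (Finset.mem_range.1 hk))
    _ = ε / (T + 1) * ((T * (n + 1) : ℕ) * (h n : ℝ)) := by
        rw [Finset.sum_const, Finset.card_range, nsmul_eq_mul]; ring
    _ = ε / (T + 1) * T := by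
        congr 1
        exact_mod_cast congrArg NNReal.toReal (hmh n)
    _ < ε := by
        rw [div_mul_eq_mul_div, div_lt_iff₀ (by positivity)]
        linarith

/-- A process with local rates `Q`, observed when the distance `d` has been traveled at the speed
`v (B t)`, has the transition probabilities `exp (d • V⁻¹ * Q)`. -/
theorem HasLocalRates.measureReal_stopped_eq (hQ : HasLocalRates P Q B)
    (hB : ∀ t, Measurable (B t))
    (hc : ∀ ω t, ContinuousWithinAt (fun u => B u ω) (Set.Ici t) t) (hv : ∀ i, 0 < v i)
    (hd : 0 ≤ d) {τ : Ω → ℝ≥0}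
    (hτ : ∀ ω, IsLeast {t | d ≤ traveledDistance (fun u => v (B u ω)) t} (τ ω)) (s s' : S) :
    P.real ({ω | B 0 ω = s} ∩ {ω | B (τ ω) ω = s'}) =
      P.real {ω | B 0 ω = s} * NormedSpace.exp (d • ((Matrix.diagonal v)⁻¹ * Q)) s s' := by
  obtain ⟨ω₀⟩ := nonempty_of_isProbabilityMeasure P
  have : Nonempty S := ⟨B 0 ω₀⟩
  obtain ⟨i₀, hi₀⟩ := Finite.exists_min v
  obtain ⟨i₁, hi₁⟩ := Finite.exists_max v
  set L : Matrix S S ℝ := (Matrix.diagonal v)⁻¹ * Q with hL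
  have hgen : ∀ (x : ℝ) i, v i * (L * NormedSpace.exp (x • L)) i s' =
      ∑ j, Q i j * NormedSpace.exp (x • L) j s' := by
    intro x i
    have hunit : IsUnit (Matrix.diagonal v).det := by
      rw [Matrix.det_diagonal]
      exact (Finset.prod_pos fun i _ => hv i).ne'.isUnit
    rw [← Matrix.mul_apply, ← Matrix.diagonal_mul, hL, Matrix.mul_assoc,
      Matrix.mul_nonsing_inv_cancel_left _ _ hunit]
  have hderiv := Matrix.hasDerivAt_mul_exp_smul_apply (S := S)
  obtain ⟨hm, hint⟩ := hQ.setIntegral_stopped_eq hB hc (V := v i₁)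
    (fun i => by rw [abs_of_pos (hv i)]; exact hi₁ i) (hv i₀) hi₀ hd
    (W := fun x i => NormedSpace.exp (x • L) i s')
    (W' := fun x i => (L * NormedSpace.exp (x • L)) i s')
    (W'' := fun x i => (L * L * NormedSpace.exp (x • L)) i s')
    (fun x i => by simpa using hderiv 1 L i s' x) (fun x i => hderiv L L i s' x)
    (fun i => continuous_iff_continuousAt.2 fun x => (hderiv (L * L) L i s' x).continuousAt)
    hgen hτ (A := {ω | B 0 ω = s}) (measurable_history B le_rfl (measurableSet_singleton s))
  have hms : MeasurableSet {ω | B 0 ω = s} := hB 0 (measurableSet_singleton s)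
  -- At remaining distance zero the exponential is the identity, so `W 0` is the indicator of `s'`;
  -- its measurability along `τ` also yields that of the event `B τ = s'`.
  have h0 : ∀ i, NormedSpace.exp ((0 : ℝ) • L) i s' = if i = s' then 1 else 0 := by
    intro i
    rw [zero_smul, NormedSpace.exp_zero, Matrix.one_apply]
  simp only [h0] at hm hint
  have hms' : MeasurableSet {ω | B (τ ω) ω = s'} := by
    convert hm (measurableSet_singleton 1) using 1
    ext ω
    simp
  have hl : ∫ ω in {ω | B 0 ω = s}, (if B (τ ω) ω = s' then (1 : ℝ) else 0) ∂P =
      P.real ({ω | B 0 ω = s} ∩ {ω | B (τ ω) ω = s'}) := by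
    have : (fun ω => if B (τ ω) ω = s' then (1 : ℝ) else 0) =
        {ω | B (τ ω) ω = s'}.indicator 1 := by
      ext ω; simp [Set.indicator]
    rw [this, integral_indicator_one hms', measureReal_restrict_apply hms', Set.inter_comm]
  rw [← hl, hint, setIntegral_congr_fun hms (g := fun _ => NormedSpace.exp (d • L) s s')
    fun ω hω => by simp only [show B 0 ω = s from hω], setIntegral_const, smul_eq_mul]

end

theorem corollary1 {N : Type*} [DecidableEq N] (net : RoadNetwork N)
    {Ω : Type*} [MeasurableSpace Ω] (P : Measure Ω) [IsProbabilityMeasure P]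
    (X : ∀ a : net.arcs, ℝ≥0 → Ω → Fin (net.levels a)) (hX : net.IsCongestionProcess P X)
    (kl : net.arcs) (s s' : net.State) (hs : P {ω | net.background X 0 ω = s} ≠ 0) :
    (∀ ω, IsLeast (net.traveledTimes X kl (net.length kl) ω)
        (net.travelTime X kl (net.length kl) ω)) ∧
      (P[{ω | net.background X (net.travelTime X kl (net.length kl) ω) ω = s'} |
          {ω | net.background X 0 ω = s}]).toReal =
        NormedSpace.exp (net.length kl • ((net.V kl)⁻¹ * net.Q)) s s' := by
  have hmeas : ∀ t, Measurable (net.background X t) := fun t =>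
    measurable_pi_lambda _ fun a => (hX.markov a).measurable t
  have hc : ∀ ω t, ContinuousWithinAt (fun u => net.background X u ω) (Set.Ici t) t := fun ω t =>
    continuousWithinAt_pi.2 fun a => (hX.markov a).right_continuous ω t
  have hQ : HasLocalRates P net.Q (net.background X) :=
    hasLocalRates_kroneckerSum (fun a => (hX.markov a).measurable)
      (fun a => (hX.markov a).hasLocalRates) hX.indep
  have hv := net.velocity_pos kl
  have : Nonempty net.State := ⟨s⟩
  obtain ⟨i₀, hi₀⟩ := Finite.exists_min (net.velocity kl)
  obtain ⟨i₁, hi₁⟩ := Finite.exists_max (net.velocity kl)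
  -- By definition `traveledTimes` is the set of times at which `traveledDistance` has reached `d`.
  -- Finiteness of the state space bounds the speed above and away from zero.
  have hleast : ∀ ω, IsLeast (net.traveledTimes X kl (net.length kl) ω)
      (net.travelTime X kl (net.length kl) ω) := fun ω =>
    isLeast_sInf_traveledDistance (right_continuous_comp (net.velocity kl) hc ω)
      (fun u => by rw [abs_of_pos (hv _)]; exact hi₁ _) (hv i₀) (fun u => hi₀ _) _
  refine ⟨hleast, ?_⟩
  have hfin := hQ.measureReal_stopped_eq hmeas hc hv (net.length_nonneg kl) hleast s s'
  have h0 : (P {ω | net.background X 0 ω = s}).toReal ≠ 0 :=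
    (ENNReal.toReal_pos hs (measure_ne_top _ _)).ne'
  have hms : MeasurableSet {ω | net.background X 0 ω = s} := hmeas 0 (measurableSet_singleton s)
  rw [cond_apply hms, ENNReal.toReal_mul, ENNReal.toReal_inv]
  simp only [Measure.real] at hfin
  rw [hfin, inv_mul_cancel_left₀ h0]
  rfl
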